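/- **Proposition 2.2.** Let $X$ be a compact complex manifold of complex dimension $n$, and let $\omega(t)$ and $\widetilde\omega(t)$, $t\in[0,\infty)$, be two smooth families of Hermitian metrics on $X$ (smooth on $X\times[0,\infty)$), starting from arbitrary Hermitian metrics $\omega_0=\omega(0)$ and $\widetilde\omega_0=\widetilde\omega(0)$, both of which solve the normalised Chern-Ricci flow $$\frac{\partial\omega}{\partial t}=-\mathrm{Ric}(\omega)-\omega ,\qquad t\in[0,\infty),$$ where, for a Hermitian metric $\omega=\sqrt{-1}\sum g_{i\bar j}\,dz_i\wedge d\bar z_j$, the Chern-Ricci form is given locally by $\mathrm{Ric}(\omega)=-\sqrt{-1}\,\partial\bar\partial\log\det(g_{i\bar j})$. Suppose that there is a constant $C_0$ such that $$-C_0\,\widetilde\omega(t)\leqslant \mathrm{Ric}(\widetilde\omega(t))\leqslant C_0\,\widetilde\omega(t)\qquad\text{for all } t\geqslant 0 .$$ Define $v:X\times[0,\infty)\to\mathbb R$ by $$v(p,t)=e^{-t}\int_0^t e^{s}\,\log\left(\frac{\omega(s)^n}{\widetilde\omega(s)^n}\right)(p)\,ds .$$ Then $v$ is differentiable in $t$ on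 $[0,\infty)$ (one-sidedly at $t=0$), and there is a constant $C>0$, independent of $t$, such that $$\sup_{X}|v(\cdot,t)|+\sup_{X}\left|\frac{\partial v}{\partial t}(\cdot,t)\right|\leqslant C\qquad\text{for all } t\geqslant 0 .$$ -/

import Mathlib

open scoped Manifold ContDiff ComplexConjugate
open Set

noncomputable section

namespace ChernRicci

/-- The model space `ℂⁿ`. -/
abbrev Cn (n : ℕ) : Type := EuclideanSpace ℂ (Fin n)

/-- The coordinate derivative `∂F/∂z_i = ½ (∂/∂x_i - √-1 ∂/∂y_i) F` of a function on `ℂⁿ`. -/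
def dz {n : ℕ} (i : Fin n) (F : Cn n → ℂ) (z : Cn n) : ℂ :=
  (1 / 2) * (fderiv ℝ F z (EuclideanSpace.single i 1)
    - Complex.I * fderiv ℝ F z (EuclideanSpace.single i Complex.I))

/-- The coordinate derivative `∂F/∂z̄_i = ½ (∂/∂x_i + √-1 ∂/∂y_i) F` of a function on `ℂⁿ`. -/
def dzbar {n : ℕ} (i : Fin n) (F : Cn n → ℂ) (z : Cn n) : ℂ :=
  (1 / 2) * (fderiv ℝ F z (EuclideanSpace.single i 1)
    + Complex.I * fderiv ℝ F z (EuclideanSpace.single i Complex.I))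

section Manifold

variable {n : ℕ} {X : Type*} [TopologicalSpace X] [ChartedSpace (Cn n) X]

/-- The `(1,1)`-forms on the complex manifold `X`. The form `√-1 ∑ h_{ij̄} dz_i ∧ dz̄_j` is
represented by the sesquilinear forms `h(V, W) = ∑ h_{ij̄} V^i conj(W^j)` on the holomorphic tangent
spaces (linear in the first variable, conjugate-linear in the second); real forms correspond to
Hermitian `h`. No continuity in the base point is part of this definition. -/
abbrev Form11 (n : ℕ) (X : Type*) [TopologicalSpace X] [ChartedSpace (Cn n) X] : Type _ :=
  ∀ p : X, TangentSpace 𝓘(ℂ, Cn n) p →ₗ[ℂ] TangentSpace 𝓘(ℂ, Cn n) p →ₗ⋆[ℂ] ℂ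

/-- The inequality `α ≤ β` between real `(1,1)`-forms: `β - α` is positive semidefinite. -/
def Form11.LE (α β : Form11 n X) : Prop :=
  ∀ (p : X) (V : TangentSpace 𝓘(ℂ, Cn n) p), (α p V V).re ≤ (β p V V).re

/-- The differential `d z_p : T_pX → ℂⁿ` of the chart `e` at `p`; its `i`-th component is `dz_i`. -/
def chartDiff (e : OpenPartialHomeomorph X (Cn n)) (p : X) :
    TangentSpace 𝓘(ℂ, Cn n) p →L[ℂ] Cn n :=
  mfderiv 𝓘(ℂ, Cn n) 𝓘(ℂ, Cn n) e p

/-- The coordinate vector `∂/∂z_i` at `p` of the chart `e`. -/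
def chartVec (e : OpenPartialHomeomorph X (Cn n)) (p : X) (i : Fin n) :
    TangentSpace 𝓘(ℂ, Cn n) p :=
  (chartDiff e p).inverse (EuclideanSpace.single i 1)

/-- The components `h_{ij̄} = h(∂/∂z_i, ∂/∂z_j)` at `p` of a `(1,1)`-form in the chart `e`. -/
def Form11.comp (h : Form11 n X) (e : OpenPartialHomeomorph X (Cn n)) (p : X) :
    Matrix (Fin n) (Fin n) ℂ :=
  Matrix.of fun i j => h p (chartVec e p i) (chartVec e p j)

/-- A smooth Hermitian metric on the complex manifold `X`, identified with its fundamental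
form. -/
structure HermitianMetric (n : ℕ) (X : Type*) [TopologicalSpace X] [ChartedSpace (Cn n) X] where
  form : Form11 n X
  hermitian : ∀ (p : X) (V W : TangentSpace 𝓘(ℂ, Cn n) p), form p W V = conj (form p V W)
  pos : ∀ (p : X) (V : TangentSpace 𝓘(ℂ, Cn n) p), V ≠ 0 → 0 < (form p V V).re
  smooth : ∀ e ∈ atlas (Cn n) X, ∀ i j : Fin n,
    ContDiffOn ℝ ∞ (fun z => form.comp e (e.symm z) i j) e.target

/-- The function `log det (g_{ij̄})` in the coordinates of the chart `e`. -/
def logDet (g : HermitianMetric n X) (e : OpenPartialHomeomorph X (Cn n)) (z : Cn n) : ℝ :=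
  Real.log (g.form.comp e (e.symm z)).det.re

/-- The components `R_{ij̄} = -∂²/∂z_i∂z̄_j log det g` at `p` of the Chern-Ricci form in the
chart `e`. -/
def ricciComp (g : HermitianMetric n X) (e : OpenPartialHomeomorph X (Cn n)) (p : X)
    (i j : Fin n) : ℂ :=
  -dz i (dzbar j fun z => (logDet g e z : ℂ)) (e p)

/-- The Chern-Ricci form `Ric(ω) = -√-1 ∂∂̄ log det g`. At `p` it is computed in the preferred
chart at `p`; any other holomorphic chart gives the same form, since a change of coordinates adds
`log |det J|²` with `det J` holomorphic, which `∂∂̄` annihilates. -/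
def chernRicci (g : HermitianMetric n X) : Form11 n X := fun p =>
  LinearMap.mk₂'ₛₗ (RingHom.id ℂ) (starRingEnd ℂ)
    (fun V W => ∑ i, ∑ j, ricciComp g (chartAt (Cn n) p) p i j *
      (chartDiff (chartAt (Cn n) p) p V i * conj (chartDiff (chartAt (Cn n) p) p W j)))
    (fun V V' W => by
      simp only [map_add, PiLp.add_apply, add_mul, mul_add, Finset.sum_add_distrib])
    (fun c V W => by
      simp only [map_smul, PiLp.smul_apply, smul_eq_mul, RingHom.id_apply, Finset.mul_sum]
      refine Finset.sum_congr rfl fun i _ => Finset.sum_congr rfl fun j _ => by ring)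
    (fun V W W' => by
      simp only [map_add, PiLp.add_apply, mul_add, Finset.sum_add_distrib])
    (fun c V W => by
      simp only [map_smul, PiLp.smul_apply, smul_eq_mul, map_mul, Finset.mul_sum]
      refine Finset.sum_congr rfl fun i _ => Finset.sum_congr rfl fun j _ => by ring)

/-- A smooth solution, on the time interval `[0, ∞)`, of the normalised Chern-Ricci flow
`∂ω/∂t = -Ric(ω) - ω`. The metric at `t = 0` is the initial metric; the values of the family at
negative times are irrelevant. -/
structure IsChernRicciFlow (g : ℝ → HermitianMetric n X) : Prop where
  smooth : ∀ e ∈ atlas (Cn n) X, ∀ i j : Fin n,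
    ContDiffOn ℝ ∞ (fun y : ℝ × Cn n => (g y.1).form.comp e (e.symm y.2) i j)
      (Ici 0 ×ˢ e.target)
  flow : ∀ t : ℝ, 0 ≤ t → ∀ (p : X) (V W : TangentSpace 𝓘(ℂ, Cn n) p),
    HasDerivWithinAt (fun s : ℝ => (g s).form p V W)
      (-(chernRicci (g t) p V W) - (g t).form p V W) (Ici 0) t

/-- The ratio of volume forms `ωⁿ / ω̃ⁿ`. Since `ωⁿ = n! det(g_{ij̄}) ∏ (√-1 dz_i ∧ dz̄_i)`, it is
the quotient of the determinants of the components in any chart around the point. -/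
def volRatio (g g' : HermitianMetric n X) (p : X) : ℝ :=
  (g.form.comp (chartAt (Cn n) p) p).det.re / (g'.form.comp (chartAt (Cn n) p) p).det.re

/-- The potential `v(p, t) = e^{-t} ∫₀ᵗ eˢ log(ω(s)ⁿ / ω̃(s)ⁿ)(p) ds`. -/
def potential (g g' : ℝ → HermitianMetric n X) (p : X) (t : ℝ) : ℝ :=
  Real.exp (-t) * ∫ s in (0 : ℝ)..t, Real.exp s * Real.log (volRatio (g s) (g' s) p)

end Manifold

end ChernRicci

end

/-! Write w = log(ωⁿ/ω̃ⁿ). Then ∂v/∂t = w - v, so it suffices to bound v and w. Since √-1∂∂̄w =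
Ric(ω̃) - Ric(ω), integrating the difference of the two flow equations against eˢ gives √-1∂∂̄v = ω
- ω̃ - e^{-t}(ω₀ - ω̃₀).

Suppose first that ω̃₀ ≤ ω₀. At a space-time minimum of v with t > 0 this identity forces ω ≥ ω̃,
hence w ≥ 0, while ∂v/∂t ≤ 0 gives v ≥ w; so v ≥ 0 (`potential_nonneg`). If moreover |Ric(ω̃)| ≤
Cω̃, the maximum principle for w - Av and -w - Av with A = C + 1 yields |w| ≤ Av + K
(`exists_abs_logRatio_le`). The term -Av contributes the multiples of ω and ω̃ that absorb both
Ricci forms; the lower bound also uses that tr_ω ω̃ dominates a multiple of -w, by concavity of log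
det.

For arbitrary initial metrics, the flow has a scaling symmetry: `rescale` turns ω̃(t) into a
solution starting at lω̃₀, by a bounded conformal factor and a time change at bounded distance from
the identity. Bounded Ricci curvature makes log ω̃ⁿ Lipschitz in time, so w and v change by bounded
amounts (`abs_logRatio_sub_rescale_le`, `abs_potential_sub_le`). By compactness M⁻¹ω̃₀ ≤ ω₀ ≤ Nω̃₀.
The first comparison bounds v below, the second with the roles exchanged bounds v above, and then
|w| ≤ Av + K bounds w.

Spatial second-order conditions are tested along real lines: the Levi form in direction U is a
quarter of the sum of second derivatives along U and √-1U (`levi_eq`), so only one-variable calculus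
and differentiation under the time integral are needed. -/

noncomputable section

namespace ChernRicci

/-! ### Determinants, traces and unitary frames of Hermitian forms -/

section LinearAlgebra

open Matrix ComplexOrder

variable {n : ℕ}

/-- Apply log x ≤ x - 1 to each eigenvalue; this is concavity of log det at the identity. -/
lemma log_det_le_trace_sub {M : Matrix (Fin n) (Fin n) ℂ} (hM : M.PosDef) :
    Real.log M.det.re ≤ M.trace.re - n := by
  have hd : M.det.re = ∏ i, hM.1.eigenvalues i := by
    rw [hM.1.det_eq_prod_eigenvalues, ← Complex.ofReal_re (∏ i, hM.1.eigenvalues i)]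
    push_cast
    rfl
  have ht : M.trace.re = ∑ i, hM.1.eigenvalues i := by
    rw [hM.1.trace_eq_sum_eigenvalues, ← Complex.ofReal_re (∑ i, hM.1.eigenvalues i)]
    push_cast
    rfl
  rw [hd, ht, Real.log_prod fun i _ => (hM.eigenvalues_pos i).ne']
  calc ∑ i, Real.log (hM.1.eigenvalues i) ≤ ∑ i, (hM.1.eigenvalues i - 1) :=
        Finset.sum_le_sum fun i _ => Real.log_le_sub_one_of_pos (hM.eigenvalues_pos i)
    _ = _ := by simp

lemma exists_conj_eq_one {G : Matrix (Fin n) (Fin n) ℂ} (hG : G.PosDef) :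
    ∃ P : Matrix (Fin n) (Fin n) ℂ, P * G * Pᴴ = 1 := by
  open scoped MatrixOrder in
  obtain ⟨B, hB⟩ := CStarAlgebra.nonneg_iff_eq_star_mul_self.mp hG.posSemidef.nonneg
  rw [star_eq_conjTranspose] at hB
  have hu : IsUnit B.det := by
    have := (isUnit_iff_isUnit_det _).mp hG.isUnit
    rw [hB, det_mul] at this
    exact isUnit_of_mul_isUnit_right this
  refine ⟨(B⁻¹)ᴴ, ?_⟩
  rw [hB, conjTranspose_conjTranspose, ← Matrix.mul_assoc, ← conjTranspose_mul,
    mul_nonsing_inv _ hu, conjTranspose_one, Matrix.one_mul, mul_nonsing_inv _ hu]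

variable {E : Type*} [AddCommGroup E] [Module ℂ E]

/-- The matrix of a sesquilinear form with respect to a family of vectors. -/
def gram (β : E →ₗ[ℂ] E →ₗ⋆[ℂ] ℂ) (b : Fin n → E) : Matrix (Fin n) (Fin n) ℂ :=
  Matrix.of fun i j => β (b i) (b j)

lemma gram_change (β : E →ₗ[ℂ] E →ₗ⋆[ℂ] ℂ) (b : Fin n → E) (J : Matrix (Fin n) (Fin n) ℂ) :
    gram β (fun i => ∑ j, J i j • b j) = J * gram β b * Jᴴ := by
  ext i j
  simp only [gram, of_apply, map_sum, map_smul, LinearMap.map_smulₛₗ, LinearMap.sum_apply,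
    LinearMap.smul_apply, mul_apply, conjTranspose_apply, smul_eq_mul, Finset.sum_mul,
    Finset.mul_sum]
  refine Finset.sum_congr rfl fun k _ => Finset.sum_congr rfl fun l _ => ?_
  rw [Complex.star_def]; ring

/-- The forms are linear in the first slot, so the column `x` corresponds to the vector with
conjugated coordinates. -/
lemma dotProduct_gram (β : E →ₗ[ℂ] E →ₗ⋆[ℂ] ℂ) (b : Fin n → E) (x : Fin n → ℂ) :
    star x ⬝ᵥ (gram β b *ᵥ x) = β (∑ i, star (x i) • b i) (∑ i, star (x i) • b i) := by
  simp only [gram, of_apply, map_sum, map_smul, LinearMap.map_smulₛₗ, LinearMap.sum_apply,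
    LinearMap.smul_apply, smul_eq_mul, dotProduct, mulVec, Finset.mul_sum, Pi.star_apply]
  rw [Finset.sum_comm]
  refine Finset.sum_congr rfl fun k _ => Finset.sum_congr rfl fun l _ => ?_
  simp only [Complex.star_def, Complex.conj_conj]
  ring

lemma posDef_gram {β : E →ₗ[ℂ] E →ₗ⋆[ℂ] ℂ} (hβ : ∀ V W, β W V = conj (β V W))
    (hpos : ∀ V, V ≠ 0 → 0 < (β V V).re) {b : Fin n → E} (hb : LinearIndependent ℂ b) :
    (gram β b).PosDef := by
  refine PosDef.of_dotProduct_mulVec_pos ?_ fun x hx => ?_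
  · ext i j
    simp only [gram, conjTranspose_apply, of_apply]
    exact (hβ _ _).symm
  · rw [dotProduct_gram]
    have hne : ∑ i, star (x i) • b i ≠ 0 := by
      intro h0
      refine hx (funext fun i => ?_)
      have := Fintype.linearIndependent_iff.mp hb _ h0 i
      simpa using this
    rw [Complex.pos_iff]
    refine ⟨hpos _ hne, ?_⟩
    have := hβ (∑ i, star (x i) • b i) (∑ i, star (x i) • b i)
    exact (Complex.conj_eq_iff_im.mp this.symm).symm

/-- An orthonormal frame for a positive definite form computes traces, and `log det` is dominated
by its tangent hyperplane. -/
lemma exists_frame {β : E →ₗ[ℂ] E →ₗ⋆[ℂ] ℂ} (hβ : ∀ V W, β W V = conj (β V W))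
    (hpos : ∀ V, V ≠ 0 → 0 < (β V V).re) {b : Fin n → E} (hb : LinearIndependent ℂ b) :
    ∃ v : Fin n → E, (∑ k, (β (v k) (v k)).re = n) ∧
      ∀ γ : E →ₗ[ℂ] E →ₗ⋆[ℂ] ℂ, (∀ V W, γ W V = conj (γ V W)) →
        (∀ V, V ≠ 0 → 0 < (γ V V).re) →
        Real.log (gram γ b).det.re - Real.log (gram β b).det.re ≤
          ∑ k, (γ (v k) (v k)).re - n := by
  have hG := posDef_gram hβ hpos hb
  obtain ⟨P, hP⟩ := exists_conj_eq_one hG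
  refine ⟨fun i => ∑ j, P i j • b j, ?_, fun γ hγ hγpos => ?_⟩
  · have : gram β (fun i => ∑ j, P i j • b j) = 1 := by rw [gram_change, hP]
    have h2 : ∀ k, β (∑ j, P k j • b j) (∑ j, P k j • b j) = 1 := fun k => by
      have := congrFun (congrFun this k) k
      simpa [gram] using this
    rw [Finset.sum_congr rfl fun k _ => congrArg Complex.re (h2 k)]
    simp
  · have hG' := posDef_gram hγ hγpos hb
    have hdet := congrArg Matrix.det hP
    rw [det_mul, det_mul, det_conjTranspose, det_one] at hdet
    have hPu : IsUnit P := by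
      rw [isUnit_iff_isUnit_det, isUnit_iff_ne_zero]
      intro h0
      simp [h0] at hdet
    have hpd : (P * gram γ b * Pᴴ).PosDef := by
      have := (hPu.posDef_star_right_conjugate_iff (x := gram γ b)).mpr hG'
      simpa [star_eq_conjTranspose] using this
    have hlog := log_det_le_trace_sub hpd
    have htr : (P * gram γ b * Pᴴ).trace.re = ∑ k, (γ (∑ j, P k j • b j) (∑ j, P k j • b j)).re := by
      rw [← gram_change]
      simp [trace, gram]
    rw [htr] at hlog
    have hd1 := (Complex.pos_iff.mp hG.det_pos)
    have hd2 := (Complex.pos_iff.mp hG'.det_pos)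
    -- The normalisation of `P` says |det P|² · det(gram β b) = 1.
    have key : (P * gram γ b * Pᴴ).det.re * (gram β b).det.re = (gram γ b).det.re := by
      have e1 : (P * gram γ b * Pᴴ).det * (gram β b).det = (gram γ b).det := by
        rw [det_mul, det_mul, det_conjTranspose]
        calc _ = (gram γ b).det * (P.det * (gram β b).det * star P.det) := by ring
          _ = _ := by rw [hdet, mul_one]
      have := congrArg Complex.re e1
      rw [Complex.mul_re, ← hd1.2, mul_zero, sub_zero] at this
      exact this
    have hpos3 := (Complex.pos_iff.mp hpd.det_pos).1
    rw [← key, Real.log_mul hpos3.ne' hd1.1.ne']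
    linarith

lemma det_gram_change (β : E →ₗ[ℂ] E →ₗ⋆[ℂ] ℂ) (b : Fin n → E) (J : Matrix (Fin n) (Fin n) ℂ) :
    (gram β (fun i => ∑ j, J i j • b j)).det.re = Complex.normSq J.det * (gram β b).det.re := by
  rw [gram_change, det_mul, det_mul, det_conjTranspose, mul_right_comm, Complex.star_def,
    Complex.mul_conj, Complex.re_ofReal_mul]

end LinearAlgebra

/-! ### Metrics in holomorphic charts -/

section Charts

open ComplexOrder

variable {n : ℕ} {X : Type*} [TopologicalSpace X] [ChartedSpace (Cn n) X]

lemma chartVec_linearIndependent [IsManifold 𝓘(ℂ, Cn n) ω X] {e : OpenPartialHomeomorph X (Cn n)}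
    (he : e ∈ atlas (Cn n) X) {p : X} (hp : p ∈ e.source) :
    LinearIndependent ℂ (chartVec e p) ∧ ∀ V, V = ∑ i, chartDiff e p V i • chartVec e p i := by
  have : IsManifold 𝓘(ℂ, Cn n) 1 X := IsManifold.of_le (n := ω) le_top
  let L : TangentSpace 𝓘(ℂ, Cn n) p ≃L[ℂ] Cn n := (mdifferentiable_of_mem_atlas (I := 𝓘(ℂ, Cn n)) he).mfderiv hp
  have hL : (chartDiff e p) = (L : TangentSpace 𝓘(ℂ, Cn n) p →L[ℂ] Cn n) := rfl
  have hinv : (chartDiff e p).inverse = (L.symm : Cn n →L[ℂ] TangentSpace 𝓘(ℂ, Cn n) p) := by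
    rw [hL]; exact ContinuousLinearMap.inverse_equiv L
  have hvec : chartVec e p = fun i => L.symm (EuclideanSpace.single i (1 : ℂ) : Cn n) := by
    funext i
    simp only [chartVec, hinv]
    rfl
  constructor
  · rw [hvec]
    have h1 : LinearIndependent ℂ fun i => (EuclideanSpace.single i (1 : ℂ) : Cn n) := by
      have := (EuclideanSpace.basisFun (Fin n) ℂ).toBasis.linearIndependent
      rw [OrthonormalBasis.coe_toBasis, funext (EuclideanSpace.basisFun_apply (Fin n) ℂ)] at this
      exact this
    exact h1.map' L.symm.toLinearEquiv.toLinearMap (LinearEquiv.ker _)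
  · intro V
    have h1 : (L V : Cn n) = ∑ i, (L V : Cn n) i • (EuclideanSpace.single i (1 : ℂ) : Cn n) := by
      have := (EuclideanSpace.basisFun (Fin n) ℂ).sum_repr (L V)
      simpa using this.symm
    have h2 := congrArg L.symm h1
    rw [L.symm_apply_apply] at h2
    rw [hvec]
    refine h2.trans ?_
    exact (map_sum L.symm _ _).trans (Finset.sum_congr rfl fun i _ => map_smul L.symm _ _)

lemma exists_chartDiff_eq [IsManifold 𝓘(ℂ, Cn n) ω X] {e : OpenPartialHomeomorph X (Cn n)}
    (he : e ∈ atlas (Cn n) X) {p : X} (hp : p ∈ e.source) (U : Cn n) :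
    ∃ V, chartDiff e p V = U := by
  have : IsManifold 𝓘(ℂ, Cn n) 1 X := IsManifold.of_le (n := ω) le_top
  exact (mdifferentiable_of_mem_atlas (I := 𝓘(ℂ, Cn n)) he).mfderiv_surjective hp U

lemma comp_posDef [IsManifold 𝓘(ℂ, Cn n) ω X] (g : HermitianMetric n X)
    {e : OpenPartialHomeomorph X (Cn n)} (he : e ∈ atlas (Cn n) X) {p : X} (hp : p ∈ e.source) :
    (g.form.comp e p).PosDef :=
  posDef_gram (g.hermitian p) (g.pos p) (chartVec_linearIndependent he hp).1

lemma comp_det_pos [IsManifold 𝓘(ℂ, Cn n) ω X] (g : HermitianMetric n X)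
    {e : OpenPartialHomeomorph X (Cn n)} (he : e ∈ atlas (Cn n) X) {p : X} (hp : p ∈ e.source) :
    0 < (g.form.comp e p).det.re :=
  (Complex.pos_iff.mp (comp_posDef g he hp).det_pos).1

/-- The ratio of volume forms may be computed in any chart. -/
lemma log_volRatio_eq [IsManifold 𝓘(ℂ, Cn n) ω X] (g g' : HermitianMetric n X)
    {e : OpenPartialHomeomorph X (Cn n)} (he : e ∈ atlas (Cn n) X) {p : X} (hp : p ∈ e.source) :
    Real.log (volRatio g g' p) = logDet g e (e p) - logDet g' e (e p) := by
  have hc := chart_mem_atlas (Cn n) p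
  have hpc := mem_chart_source (Cn n) p
  obtain ⟨-, hspan⟩ := chartVec_linearIndependent he hp
  let J : Matrix (Fin n) (Fin n) ℂ := Matrix.of fun i j =>
    chartDiff e p (chartVec (chartAt (Cn n) p) p i) j
  have hJ : ∀ h : HermitianMetric n X, (h.form.comp (chartAt (Cn n) p) p).det.re =
      Complex.normSq J.det * (h.form.comp e p).det.re := by
    intro h
    have : h.form.comp (chartAt (Cn n) p) p =
        gram (h.form p) (fun i => ∑ j, J i j • chartVec e p j) := by
      ext i j
      simp only [Form11.comp, gram, Matrix.of_apply]
      congr 1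
      · congr 1
        exact hspan _
      · exact hspan _
    rw [this, det_gram_change]
    rfl
  have h1 := comp_det_pos g hc hpc
  have hJ0 : Complex.normSq J.det ≠ 0 := by
    intro h0
    rw [hJ, h0, zero_mul] at h1
    exact lt_irrefl _ h1
  rw [volRatio, hJ, hJ, mul_div_mul_left _ _ hJ0,
    Real.log_div (comp_det_pos g he hp).ne' (comp_det_pos g' he hp).ne', logDet, logDet,
    e.left_inv hp]

/-- A unitary frame of a Hermitian metric at a point: `∑ₖ β(vₖ, vₖ)` is then the trace of `β` with
respect to the metric, and by concavity `log det` lies below its linearisation. -/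
def HermitianMetric.IsFrame (g : HermitianMetric n X) (p : X)
    (v : Fin n → TangentSpace 𝓘(ℂ, Cn n) p) : Prop :=
  (∑ k, (g.form p (v k) (v k)).re = n) ∧
    ∀ h : HermitianMetric n X,
      logDet h (chartAt (Cn n) p) (chartAt (Cn n) p p) -
        logDet g (chartAt (Cn n) p) (chartAt (Cn n) p p) ≤
        ∑ k, (h.form p (v k) (v k)).re - n

lemma HermitianMetric.exists_isFrame [IsManifold 𝓘(ℂ, Cn n) ω X] (g : HermitianMetric n X)
    (p : X) : ∃ v, g.IsFrame p v := by
  have hp := mem_chart_source (Cn n) p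
  obtain ⟨v, hv, hv'⟩ := ChernRicci.exists_frame (g.hermitian p) (g.pos p)
    (chartVec_linearIndependent (chart_mem_atlas (Cn n) p) hp).1
  refine ⟨v, hv, fun h => ?_⟩
  rw [logDet, logDet, (chartAt (Cn n) p).left_inv hp]
  exact hv' (h.form p) (h.hermitian p) (h.pos p)

end Charts

/-! ### Regularity of log det and its evolution along the flow -/

section Smoothness

open Filter Topology

variable {n : ℕ} {X : Type*} [TopologicalSpace X] [ChartedSpace (Cn n) X]

lemma contDiffOn_logDet [IsManifold 𝓘(ℂ, Cn n) ω X] {g : ℝ → HermitianMetric n X}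
    (hg : IsChernRicciFlow g) {e : OpenPartialHomeomorph X (Cn n)} (he : e ∈ atlas (Cn n) X) :
    ContDiffOn ℝ ∞ (fun y : ℝ × Cn n => logDet (g y.1) e y.2) (Ici 0 ×ˢ e.target) := by
  have hdet : ContDiffOn ℝ ∞
      (fun y : ℝ × Cn n => ((g y.1).form.comp e (e.symm y.2)).det) (Ici 0 ×ˢ e.target) := by
    simp only [Matrix.det_apply]
    refine ContDiffOn.sum fun σ _ => ContDiffOn.const_smul _ ?_
    exact contDiffOn_prod fun i _ => hg.smooth e he _ _
  refine ContDiffOn.log (Complex.reCLM.contDiff.comp_contDiffOn hdet) ?_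
  rintro ⟨s, z⟩ ⟨-, hz⟩
  exact (comp_det_pos (g s) he (e.map_target hz)).ne'

/-- The logarithm of the ratio of the volume forms of two families of metrics. -/
def logRatio (g g' : ℝ → HermitianMetric n X) (p : X) (s : ℝ) : ℝ :=
  Real.log (volRatio (g s) (g' s) p)

lemma continuousOn_logRatio [IsManifold 𝓘(ℂ, Cn n) ω X] {g g' : ℝ → HermitianMetric n X}
    (hg : IsChernRicciFlow g) (hg' : IsChernRicciFlow g') :
    ContinuousOn (fun y : X × ℝ => logRatio g g' y.1 y.2) (univ ×ˢ Ici 0) := by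
  rintro ⟨p, s⟩ ⟨-, hs⟩
  let e := chartAt (Cn n) p
  have he : e ∈ atlas (Cn n) X := chart_mem_atlas _ p
  have hk : ContinuousOn (fun y : ℝ × Cn n => logDet (g y.1) e y.2 - logDet (g' y.1) e y.2)
      -- `volRatio` uses a chart that varies with the point; near `p` everything is moved to the
      -- single chart `e`.
      (Ici 0 ×ˢ e.target) :=
    (contDiffOn_logDet hg he).continuousOn.sub (contDiffOn_logDet hg' he).continuousOn
  have hm : ContinuousOn (fun y : X × ℝ => (y.2, e y.1)) (e.source ×ˢ Ici 0) :=
    continuousOn_snd.prodMk (e.continuousOn.comp continuousOn_fst fun y hy => hy.1)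
  have hc := hk.comp hm fun y hy => ⟨hy.2, e.map_source hy.1⟩
  have hc' : ContinuousOn (fun y : X × ℝ => logRatio g g' y.1 y.2) (e.source ×ˢ Ici 0) :=
    hc.congr fun y hy => log_volRatio_eq _ _ he hy.1
  have hmem : (p, s) ∈ e.source ×ˢ Ici (0 : ℝ) := ⟨mem_chart_source _ p, hs⟩
  refine (hc' _ hmem).mono_of_mem_nhdsWithin ?_
  rw [nhdsWithin_prod_eq, nhdsWithin_univ]
  exact prod_mem_prod (e.open_source.mem_nhds hmem.1) self_mem_nhdsWithin

lemma continuousOn_logRatio_right [IsManifold 𝓘(ℂ, Cn n) ω X] {g g' : ℝ → HermitianMetric n X}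
    (hg : IsChernRicciFlow g) (hg' : IsChernRicciFlow g') (p : X) :
    ContinuousOn (logRatio g g' p) (Ici 0) :=
  (continuousOn_logRatio hg hg').comp (f := fun s => (p, s))
    (by fun_prop) fun _ hs => ⟨mem_univ _, hs⟩

lemma hasDerivAt_form_re {g : ℝ → HermitianMetric n X} (hg : IsChernRicciFlow g) {t : ℝ}
    (ht : 0 < t) (p : X) (V : TangentSpace 𝓘(ℂ, Cn n) p) :
    HasDerivAt (fun s => ((g s).form p V V).re)
      (-(chernRicci (g t) p V V).re - ((g t).form p V V).re) t := by
  have h := (hg.flow t ht.le p V V).hasDerivAt (Ici_mem_nhds ht)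
  have h2 := Complex.reCLM.hasFDerivAt.comp_hasDerivAt t h
  rw [map_sub, map_neg] at h2
  exact h2

/-- Along the flow, `∂/∂t log det g` is the trace of `∂g/∂t`. -/
lemma hasDerivAt_logDet [IsManifold 𝓘(ℂ, Cn n) ω X] {g : ℝ → HermitianMetric n X}
    (hg : IsChernRicciFlow g) {t : ℝ} (ht : 0 < t) {p : X} {v : Fin n → TangentSpace 𝓘(ℂ, Cn n) p}
    (hv : (g t).IsFrame p v) :
    HasDerivAt (fun s => logDet (g s) (chartAt (Cn n) p) (chartAt (Cn n) p p))
      (-(∑ k, (chernRicci (g t) p (v k) (v k)).re) - n) t := by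
  let e := chartAt (Cn n) p
  have he : e ∈ atlas (Cn n) X := chart_mem_atlas _ p
  have hφ : DifferentiableAt ℝ (fun s => logDet (g s) e (e p)) t := by
    have h1 : ContDiffOn ℝ ∞ (fun s => logDet (g s) e (e p)) (Ici 0) :=
      (contDiffOn_logDet hg he).comp (f := fun s : ℝ => (s, e p))
        (contDiff_id.prodMk contDiff_const).contDiffOn
        fun s hs => ⟨hs, e.map_source (mem_chart_source _ p)⟩
    exact ((h1.differentiableOn (by simp)) t ht.le).differentiableAt (Ici_mem_nhds ht)
  have hψ : HasDerivAt (fun s => ∑ k, ((g s).form p (v k) (v k)).re)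
      (∑ k, (-(chernRicci (g t) p (v k) (v k)).re - ((g t).form p (v k) (v k)).re)) t :=
    HasDerivAt.fun_sum fun k _ => hasDerivAt_form_re hg ht p (v k)
  -- The tangent-hyperplane inequality is an equality at s = t, so the two sides have equal
  -- derivatives there; this replaces Jacobi's formula.
  have hmax : IsLocalMax (fun s => logDet (g s) e (e p) - ∑ k, ((g s).form p (v k) (v k)).re) t :=
    Eventually.of_forall fun s => by
      have := hv.2 (g s)
      have h2 := hv.1
      simp only [e]
      linarith
  have h0 := hmax.hasDerivAt_eq_zero (hφ.hasDerivAt.sub hψ)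
  have := hφ.hasDerivAt
  rw [sub_eq_zero.mp h0, Finset.sum_sub_distrib, Finset.sum_neg_distrib, hv.1] at this
  exact this

end Smoothness

/-! ### One-variable second derivative test under a time integral -/

section Calculus

open Filter Topology MeasureTheory

/-- The derivative is taken within the closed half-space of times, yet it is a genuine derivative in
`x`, whose range is open. The same regularity of `k'` permits iteration. -/
lemma exists_partial_deriv {k : ℝ × ℝ → ℝ} {a b : ℝ}
    (hk : ContDiffOn ℝ ∞ k (Ici 0 ×ˢ Ioo a b)) :
    ∃ k' : ℝ × ℝ → ℝ, ContDiffOn ℝ ∞ k' (Ici 0 ×ˢ Ioo a b) ∧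
      ∀ s, 0 ≤ s → ∀ x ∈ Ioo a b, HasDerivAt (fun x => k (s, x)) (k' (s, x)) x := by
  have hu : UniqueDiffOn ℝ (Ici (0 : ℝ) ×ˢ Ioo a b) :=
    (uniqueDiffOn_Ici 0).prod isOpen_Ioo.uniqueDiffOn
  refine ⟨fun y => fderivWithin ℝ k (Ici 0 ×ˢ Ioo a b) y (0, 1), ?_, fun s hs x hx => ?_⟩
  · exact (hk.fderivWithin hu (m := ∞) (by simp)).clm_apply contDiffOn_const
  · have h1 := ((hk.differentiableOn (by simp)) (s, x) ⟨hs, hx⟩).hasFDerivWithinAt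
    have h2 : HasDerivWithinAt (fun x : ℝ => (s, x)) ((0 : ℝ), (1 : ℝ)) (Ioo a b) x :=
      (hasDerivWithinAt_const x _ s).prodMk (hasDerivWithinAt_id x _)
    have h3 := h1.comp_hasDerivWithinAt x h2 fun y hy => ⟨hs, hy⟩
    exact h3.hasDerivAt (Ioo_mem_nhds hx.1 hx.2)

lemma continuousOn_slice {k : ℝ × ℝ → ℝ} {a b : ℝ} (hk : ContinuousOn k (Ici 0 ×ˢ Ioo a b))
    {x : ℝ} (hx : x ∈ Ioo a b) : ContinuousOn (fun s => k (s, x)) (Ici 0) :=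
  hk.comp (f := fun s => (s, x)) (by fun_prop) fun _ hs => ⟨hs, hx⟩

lemma intervalIntegrable_of_continuousOn_Ici {f : ℝ → ℝ} (hf : ContinuousOn f (Ici 0)) {t : ℝ}
    (ht : 0 ≤ t) : IntervalIntegrable f volume 0 t :=
  (hf.mono fun s hs => by rw [uIcc_of_le ht] at hs; exact hs.1).intervalIntegrable

lemma hasDerivAt_integral_exp_mul {k k' : ℝ × ℝ → ℝ} {a b : ℝ}
    (hk : ContinuousOn k (Ici 0 ×ˢ Ioo a b)) (hk' : ContinuousOn k' (Ici 0 ×ˢ Ioo a b))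
    (hd : ∀ s, 0 ≤ s → ∀ x ∈ Ioo a b, HasDerivAt (fun x => k (s, x)) (k' (s, x)) x)
    {t : ℝ} (ht : 0 ≤ t) {x : ℝ} (hx : x ∈ Ioo a b) :
    HasDerivAt (fun x => ∫ s in (0 : ℝ)..t, Real.exp s * k (s, x))
      (∫ s in (0 : ℝ)..t, Real.exp s * k' (s, x)) x := by
  obtain ⟨δ, hδ, hball⟩ := Metric.nhds_basis_closedBall.mem_iff.mp (Ioo_mem_nhds hx.1 hx.2)
  have hcont : ∀ {f : ℝ × ℝ → ℝ}, ContinuousOn f (Ici 0 ×ˢ Ioo a b) → ∀ y ∈ Ioo a b,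
      IntervalIntegrable (fun s => Real.exp s * f (s, y)) volume 0 t := fun hf y hy =>
    intervalIntegrable_of_continuousOn_Ici
      (Real.continuous_exp.continuousOn.mul (continuousOn_slice hf hy)) ht
  have hmeas : ∀ {f : ℝ → ℝ}, IntervalIntegrable f volume 0 t →
      AEStronglyMeasurable f (volume.restrict (uIoc 0 t)) := fun h => by
    rw [uIoc_of_le ht]; exact h.1.aestronglyMeasurable
  have hcpt : IsCompact (Icc 0 t ×ˢ Metric.closedBall x δ) :=
    isCompact_Icc.prod (isCompact_closedBall x δ)
  have hsub : Icc 0 t ×ˢ Metric.closedBall x δ ⊆ Ici 0 ×ˢ Ioo a b :=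
    fun y hy => ⟨hy.1.1, hball hy.2⟩
  obtain ⟨M, hM⟩ := hcpt.exists_bound_of_continuousOn
    (f := fun y : ℝ × ℝ => Real.exp y.1 * k' y)
    ((Real.continuous_exp.comp continuous_fst).continuousOn.mul (hk'.mono hsub))
  refine (intervalIntegral.hasDerivAt_integral_of_dominated_loc_of_deriv_le
    (F := fun x s => Real.exp s * k (s, x)) (F' := fun x s => Real.exp s * k' (s, x))
    (bound := fun _ => M) (Metric.closedBall_mem_nhds x hδ) ?_ (hcont hk x hx)
    (hmeas (hcont hk' x hx)) ?_ (intervalIntegrable_const) ?_).2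
  · filter_upwards [Ioo_mem_nhds hx.1 hx.2] with y hy
    exact hmeas (hcont hk y hy)
  · refine Eventually.of_forall fun s hs y hy => ?_
    rw [uIoc_of_le ht] at hs
    exact hM (s, y) ⟨⟨hs.1.le, hs.2⟩, hy⟩
  · refine Eventually.of_forall fun s hs y hy => ?_
    rw [uIoc_of_le ht] at hs
    exact (hd s hs.1.le y (hball hy)).const_mul _

/-- If `c` were positive, the point would also be a local minimum, so `f` would be locally constant
and `c` zero. -/
lemma second_deriv_nonpos_of_isLocalMax {f f' : ℝ → ℝ} {c x₀ : ℝ}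
    (hf : ∀ᶠ x in 𝓝 x₀, HasDerivAt f (f' x) x) (hf' : HasDerivAt f' c x₀)
    (hmax : IsLocalMax f x₀) : c ≤ 0 := by
  by_contra! hc
  have he : deriv f =ᶠ[𝓝 x₀] f' := hf.mono fun x hx => hx.deriv
  have hdd : deriv (deriv f) x₀ = c := by rw [he.deriv_eq, hf'.deriv]
  have hmin := isLocalMin_of_deriv_deriv_pos (f := f) (x₀ := x₀) (by rw [hdd]; exact hc)
    hmax.deriv_eq_zero hf.self_of_nhds.continuousAt
  have hconst : f =ᶠ[𝓝 x₀] fun _ => f x₀ := by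
    filter_upwards [hmax, hmin] with x h1 h2 using le_antisymm h1 h2
  have h0 : deriv f =ᶠ[𝓝 x₀] fun _ => 0 :=
    hconst.deriv.trans (Eventually.of_forall fun x => by simp)
  rw [h0.deriv_eq] at hdd
  simp at hdd
  exact hc.ne hdd

/-- The second derivative test for a combination of a function and of its weighted time average. -/
lemma second_deriv_test_average {k : ℝ × ℝ → ℝ} {a b x₀ : ℝ} (hx₀ : x₀ ∈ Ioo a b)
    (hk : ContDiffOn ℝ ∞ k (Ici 0 ×ˢ Ioo a b)) :
    ContinuousOn (fun s => deriv (deriv fun x => k (s, x)) x₀) (Ici 0) ∧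
    ∀ t, 0 ≤ t → ∀ α β : ℝ,
      IsLocalMax (fun x => α * k (t, x) + β * ∫ s in (0 : ℝ)..t, Real.exp s * k (s, x)) x₀ →
      α * deriv (deriv fun x => k (t, x)) x₀ +
        β * ∫ s in (0 : ℝ)..t, Real.exp s * deriv (deriv fun x => k (s, x)) x₀ ≤ 0 := by
  obtain ⟨k₁, hk₁, hd₁⟩ := exists_partial_deriv hk
  obtain ⟨k₂, hk₂, hd₂⟩ := exists_partial_deriv hk₁
  have hdd : ∀ s, 0 ≤ s → deriv (deriv fun x => k (s, x)) x₀ = k₂ (s, x₀) := by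
    intro s hs
    have : deriv (fun x => k (s, x)) =ᶠ[𝓝 x₀] fun x => k₁ (s, x) := by
      filter_upwards [Ioo_mem_nhds hx₀.1 hx₀.2] with x hx using (hd₁ s hs x hx).deriv
    rw [this.deriv_eq, (hd₂ s hs x₀ hx₀).deriv]
  refine ⟨(continuousOn_slice hk₂.continuousOn hx₀).congr hdd, fun t ht α β hmax => ?_⟩
  have hint : ∫ s in (0 : ℝ)..t, Real.exp s * deriv (deriv fun x => k (s, x)) x₀ =
      ∫ s in (0 : ℝ)..t, Real.exp s * k₂ (s, x₀) :=
    intervalIntegral.integral_congr fun s hs => by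
      rw [uIcc_of_le ht] at hs
      simp only [hdd s hs.1]
  rw [hint, hdd t ht]
  refine second_deriv_nonpos_of_isLocalMax
    (f' := fun x => α * k₁ (t, x) + β * ∫ s in (0 : ℝ)..t, Real.exp s * k₁ (s, x)) ?_ ?_ hmax
  · filter_upwards [Ioo_mem_nhds hx₀.1 hx₀.2] with x hx
    exact ((hd₁ t ht x hx).const_mul α).add
      ((hasDerivAt_integral_exp_mul hk.continuousOn hk₁.continuousOn hd₁ ht hx).const_mul β)
  · exact ((hd₂ t ht x₀ hx₀).const_mul α).add
      ((hasDerivAt_integral_exp_mul hk₁.continuousOn hk₂.continuousOn hd₂ ht hx₀).const_mul β)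

end Calculus

/-! ### The Levi form through real second derivatives -/

section Levi

open Filter Topology

variable {n : ℕ}

lemma deriv_deriv_line {f : Cn n → ℝ} {z : Cn n} (hf : ContDiffAt ℝ 2 f z) (U : Cn n) :
    (∀ᶠ x : ℝ in 𝓝 0, DifferentiableAt ℝ (fun x : ℝ => f (z + x • U)) x) ∧
    HasDerivAt (deriv fun x : ℝ => f (z + x • U)) (fderiv ℝ (fderiv ℝ f) z U U) 0 := by
  have hline : ∀ x : ℝ, HasDerivAt (fun x : ℝ => z + x • U) U x := fun x => by
    simpa using ((hasDerivAt_id x).smul_const U).const_add z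
  have hev : ∀ᶠ y in 𝓝 z, DifferentiableAt ℝ f y :=
    (hf.eventually (by simp)).mono fun y hy => hy.differentiableAt (by simp)
  have hcont : Tendsto (fun x : ℝ => z + x • U) (𝓝 0) (𝓝 z) := by
    have := (hline 0).continuousAt.tendsto
    simpa using this
  have hev' : ∀ᶠ x : ℝ in 𝓝 0,
      HasDerivAt (fun x : ℝ => f (z + x • U)) (fderiv ℝ f (z + x • U) U) x :=
    (hcont.eventually hev).mono fun x hx => hx.hasFDerivAt.comp_hasDerivAt x (hline x)
  refine ⟨hev'.mono fun x hx => hx.differentiableAt, ?_⟩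
  have h2 : DifferentiableAt ℝ (fderiv ℝ f) (z + (0 : ℝ) • U) := by
    rw [zero_smul, add_zero]
    exact (hf.fderiv_right (m := 1) (by norm_num)).differentiableAt (by simp)
  have h3 := h2.hasFDerivAt.comp_hasDerivAt (0 : ℝ) (hline 0)
  have h4 := h3.clm_apply (hasDerivAt_const (0 : ℝ) U)
  have he : deriv (fun x : ℝ => f (z + x • U)) =ᶠ[𝓝 0] fun x => fderiv ℝ f (z + x • U) U :=
    hev'.mono fun x hx => hx.deriv
  refine HasDerivAt.congr_of_eventuallyEq ?_ he
  simpa using h4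

lemma dz_dzbar_eq {f : Cn n → ℝ} {z : Cn n} (hf : ContDiffAt ℝ 2 f z) (i j : Fin n) :
    let B := fderiv ℝ (fderiv ℝ f) z
    let e : Fin n → Cn n := fun i => EuclideanSpace.single i 1
    let e' : Fin n → Cn n := fun i => EuclideanSpace.single i Complex.I
    dz i (dzbar j fun z => (f z : ℂ)) z =
      (1 / 4) * ((B (e i) (e j) + B (e' i) (e' j) : ℝ) +
        Complex.I * (B (e i) (e' j) - B (e' i) (e j) : ℝ)) := by
  intro B e e'
  have hev : ∀ᶠ y in 𝓝 z, DifferentiableAt ℝ f y :=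
    (hf.eventually (by simp)).mono fun y hy => hy.differentiableAt (by simp)
  have hB : HasFDerivAt (fderiv ℝ f) B z :=
    ((hf.fderiv_right (m := 1) (by norm_num)).differentiableAt (by simp)).hasFDerivAt
  have he : dzbar j (fun z => (f z : ℂ)) =ᶠ[𝓝 z] fun y =>
      (1 / 2 : ℂ) * ((fderiv ℝ f y (e j) : ℂ) + Complex.I * (fderiv ℝ f y (e' j) : ℂ)) := by
    filter_upwards [hev] with y hy
    have : HasFDerivAt (fun z => (f z : ℂ)) (Complex.ofRealCLM.comp (fderiv ℝ f y)) y :=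
      Complex.ofRealCLM.hasFDerivAt.comp y hy.hasFDerivAt
    simp only [dzbar, this.fderiv]
    rfl
  have hap : ∀ v : Cn n, HasFDerivAt (fun y => (fderiv ℝ f y v : ℂ))
      (Complex.ofRealCLM.comp (B.flip v)) z := fun v => by
    have h1 := hB.clm_apply (hasFDerivAt_const v z)
    have h2 := Complex.ofRealCLM.hasFDerivAt.comp z h1
    rw [ContinuousLinearMap.comp_zero, zero_add] at h2
    exact h2
  have hfd := ((hap (e j)).add ((hap (e' j)).const_mul Complex.I)).const_mul (1 / 2 : ℂ)
  have hfd' := HasFDerivAt.fderiv (f := fun y =>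
    (1 / 2 : ℂ) * ((fderiv ℝ f y (e j) : ℂ) + Complex.I * (fderiv ℝ f y (e' j) : ℂ))) hfd
  rw [dz, he.fderiv_eq, hfd']
  simp only [_root_.smul_apply, _root_.add_apply,
    ContinuousLinearMap.comp_apply, ContinuousLinearMap.flip_apply, Complex.ofRealCLM_apply,
    smul_eq_mul]
  push_cast
  linear_combination (-(1/4) * (B (e' i) (e' j) : ℂ)) * Complex.I_sq

lemma bilin_expand (B : Cn n →L[ℝ] Cn n →L[ℝ] ℝ) (a b c d : Fin n → ℝ) (e e' : Fin n → Cn n) :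
    B (∑ i, (a i • e i + b i • e' i)) (∑ j, (c j • e j + d j • e' j)) =
      ∑ i, ∑ j, (a i * c j * B (e i) (e j) + a i * d j * B (e i) (e' j) +
        b i * c j * B (e' i) (e j) + b i * d j * B (e' i) (e' j)) := by
  simp only [map_sum, map_add, map_smul, _root_.sum_apply,
    _root_.add_apply, _root_.smul_apply, smul_eq_mul]
  rw [Finset.sum_comm]
  refine Finset.sum_congr rfl fun i _ => ?_
  rw [Finset.mul_sum, Finset.mul_sum, ← Finset.sum_add_distrib]
  exact Finset.sum_congr rfl fun j _ => by ring

lemma Cn_eq_sum (U : Cn n) :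
    U = ∑ i, ((U i).re • (EuclideanSpace.single i 1 : Cn n) +
      (U i).im • (EuclideanSpace.single i Complex.I : Cn n)) := by
  ext j
  simp [Pi.single_apply, Finset.sum_add_distrib, Complex.re_add_im]

/-- The Levi form of a real function is the average of second derivatives along a complex line. -/
lemma levi_eq {f : Cn n → ℝ} {z : Cn n} (hf : ContDiffAt ℝ 2 f z) (U : Cn n) :
    (∑ i, ∑ j, dz i (dzbar j fun z => (f z : ℂ)) z * (U i * conj (U j))).re =
      (1 / 4) * (deriv (deriv fun x : ℝ => f (z + x • U)) 0 +
        deriv (deriv fun x : ℝ => f (z + x • (Complex.I • U))) 0) := by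
  rw [(deriv_deriv_line hf U).2.deriv, (deriv_deriv_line hf _).2.deriv]
  set B := fderiv ℝ (fderiv ℝ f) z
  -- Multiplication by √-1 sends real coordinates (a, b) to (-b, a); after expanding in the real
  -- basis the identity holds for each pair (i, j) separately.
  have h1 := Cn_eq_sum U
  have h2 := Cn_eq_sum (Complex.I • U)
  have e1 : B U U = _ := (congrArg₂ (fun u v => B u v) h1 h1).trans (bilin_expand B _ _ _ _ _ _)
  have e2 : B (Complex.I • U) (Complex.I • U) = _ :=
    (congrArg₂ (fun u v => B u v) h2 h2).trans (bilin_expand B _ _ _ _ _ _)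
  rw [e1, e2, ← Finset.sum_add_distrib, Complex.re_sum, Finset.mul_sum]
  refine Finset.sum_congr rfl fun i _ => ?_
  rw [← Finset.sum_add_distrib, Complex.re_sum, Finset.mul_sum]
  refine Finset.sum_congr rfl fun j _ => ?_
  rw [dz_dzbar_eq hf]
  simp only [PiLp.smul_apply, smul_eq_mul, Complex.mul_re, Complex.mul_im, Complex.I_re,
    Complex.I_im, Complex.conj_re, Complex.conj_im, Complex.add_re, Complex.add_im,
    Complex.ofReal_re, Complex.ofReal_im]
  norm_num
  ring

end Levi

/-! ### The Chern-Ricci form along real lines -/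

section Ricci

open Filter Topology

variable {n : ℕ} {X : Type*} [TopologicalSpace X] [ChartedSpace (Cn n) X]

lemma contDiffAt_logDet [IsManifold 𝓘(ℂ, Cn n) ω X] (g : HermitianMetric n X)
    {e : OpenPartialHomeomorph X (Cn n)} (he : e ∈ atlas (Cn n) X) {z : Cn n} (hz : z ∈ e.target) :
    ContDiffAt ℝ 2 (logDet g e) z := by
  have hdet : ContDiffOn ℝ ∞ (fun y => (g.form.comp e (e.symm y)).det) e.target := by
    simp only [Matrix.det_apply]
    refine ContDiffOn.sum fun σ _ => ContDiffOn.const_smul _ ?_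
    exact contDiffOn_prod fun i _ => g.smooth e he _ _
  have h : ContDiffOn ℝ ∞ (logDet g e) e.target :=
    ContDiffOn.log (Complex.reCLM.contDiff.comp_contDiffOn hdet) fun y hy =>
      (comp_det_pos g he (e.map_target hy)).ne'
  exact (h.contDiffAt (e.open_target.mem_nhds hz)).of_le (WithTop.coe_le_coe.mpr (le_top : (2 : ℕ∞) ≤ ⊤))

lemma chernRicci_re [IsManifold 𝓘(ℂ, Cn n) ω X] (g : HermitianMetric n X) (p : X)
    (V : TangentSpace 𝓘(ℂ, Cn n) p) :
    let e := chartAt (Cn n) p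
    let U := chartDiff e p V
    (chernRicci g p V V).re =
      -((1 / 4) * (deriv (deriv fun x : ℝ => logDet g e (e p + x • U)) 0 +
        deriv (deriv fun x : ℝ => logDet g e (e p + x • (Complex.I • U))) 0)) := by
  intro e U
  have hp : e p ∈ e.target := e.map_source (mem_chart_source _ p)
  rw [← levi_eq (contDiffAt_logDet g (chart_mem_atlas _ p) hp) U, ← Complex.neg_re]
  congr 1
  simp only [chernRicci, LinearMap.mk₂'ₛₗ_apply, ricciComp, neg_mul, Finset.sum_neg_distrib]
  rfl

end Ricci

/-! ### Second-order conditions at spatial maxima -/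

section MaximumTest

open Filter Topology MeasureTheory

variable {n : ℕ} {X : Type*} [TopologicalSpace X] [ChartedSpace (Cn n) X]

/-- The logarithm of the volume ratio along a real line through `p` in the preferred chart. -/
def lineRatio (g g' : ℝ → HermitianMetric n X) (p : X) (U : Cn n) (y : ℝ × ℝ) : ℝ :=
  logDet (g y.1) (chartAt (Cn n) p) (chartAt (Cn n) p p + y.2 • U) -
    logDet (g' y.1) (chartAt (Cn n) p) (chartAt (Cn n) p p + y.2 • U)

lemma exists_line_mem_target (p : X) (U : Cn n) :
    ∃ ε : ℝ, 0 < ε ∧ ∀ x ∈ Ioo (-ε) ε, chartAt (Cn n) p p + x • U ∈ (chartAt (Cn n) p).target := by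
  have hc : Continuous fun x : ℝ => chartAt (Cn n) p p + x • U := by fun_prop
  have h0 : (chartAt (Cn n) p).target ∈ 𝓝 (chartAt (Cn n) p p + (0 : ℝ) • U) := by
    rw [zero_smul, add_zero]
    exact (chartAt (Cn n) p).open_target.mem_nhds (mem_chart_target _ p)
  obtain ⟨ε, hε, h⟩ := Metric.mem_nhds_iff.mp (hc.continuousAt.preimage_mem_nhds h0)
  refine ⟨ε, hε, fun x hx => h ?_⟩
  rwa [Real.ball_eq_Ioo, zero_sub, zero_add]

variable [IsManifold 𝓘(ℂ, Cn n) ω X]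

lemma contDiffOn_lineRatio {g g' : ℝ → HermitianMetric n X} (hg : IsChernRicciFlow g)
    (hg' : IsChernRicciFlow g') {p : X} {U : Cn n} {ε : ℝ}
    (hε : ∀ x ∈ Ioo (-ε) ε, chartAt (Cn n) p p + x • U ∈ (chartAt (Cn n) p).target) :
    ContDiffOn ℝ ∞ (lineRatio g g' p U) (Ici 0 ×ˢ Ioo (-ε) ε) := by
  have he : chartAt (Cn n) p ∈ atlas (Cn n) X := chart_mem_atlas _ p
  have hm : ContDiff ℝ ∞ (fun y : ℝ × ℝ => (y.1, chartAt (Cn n) p p + y.2 • U)) := by fun_prop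
  have hmaps : MapsTo (fun y : ℝ × ℝ => (y.1, chartAt (Cn n) p p + y.2 • U))
      (Ici 0 ×ˢ Ioo (-ε) ε) (Ici 0 ×ˢ (chartAt (Cn n) p).target) := fun y hy => ⟨hy.1, hε _ hy.2⟩
  exact ((contDiffOn_logDet hg he).comp hm.contDiffOn hmaps).sub
    ((contDiffOn_logDet hg' he).comp hm.contDiffOn hmaps)

lemma deriv_deriv_lineRatio (g g' : ℝ → HermitianMetric n X) (p : X) (U : Cn n) (s : ℝ) :
    deriv (deriv fun x => lineRatio g g' p U (s, x)) 0 =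
      deriv (deriv fun x : ℝ => logDet (g s) (chartAt (Cn n) p) (chartAt (Cn n) p p + x • U)) 0 -
      deriv (deriv fun x : ℝ =>
        logDet (g' s) (chartAt (Cn n) p) (chartAt (Cn n) p p + x • U)) 0 := by
  have he : chartAt (Cn n) p ∈ atlas (Cn n) X := chart_mem_atlas _ p
  have hp := mem_chart_target (Cn n) p
  obtain ⟨h1, h1'⟩ := deriv_deriv_line (contDiffAt_logDet (g s) he hp) U
  obtain ⟨h2, h2'⟩ := deriv_deriv_line (contDiffAt_logDet (g' s) he hp) U
  have hd : deriv (fun x => lineRatio g g' p U (s, x)) =ᶠ[𝓝 0] fun x =>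
      deriv (fun x : ℝ => logDet (g s) (chartAt (Cn n) p) (chartAt (Cn n) p p + x • U)) x -
      deriv (fun x : ℝ => logDet (g' s) (chartAt (Cn n) p) (chartAt (Cn n) p p + x • U)) x := by
    filter_upwards [h1, h2] with x hx hx'
    exact (hx.hasDerivAt.sub hx'.hasDerivAt).deriv
  rw [hd.deriv_eq, h1'.deriv, h2'.deriv]
  exact (h1'.sub h2').deriv

/-- This is √-1∂∂̄ log(ωⁿ/ω̃ⁿ) = Ric(ω̃) - Ric(ω), evaluated on `V`. -/
lemma ricci_sub_ricci (g g' : ℝ → HermitianMetric n X) (p : X) (V : TangentSpace 𝓘(ℂ, Cn n) p)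
    (s : ℝ) :
    (chernRicci (g' s) p V V).re - (chernRicci (g s) p V V).re =
      (1 / 4) * (deriv (deriv fun x =>
          lineRatio g g' p (chartDiff (chartAt (Cn n) p) p V) (s, x)) 0 +
        deriv (deriv fun x =>
          lineRatio g g' p (Complex.I • chartDiff (chartAt (Cn n) p) p V) (s, x)) 0) := by
  rw [chernRicci_re, chernRicci_re, deriv_deriv_lineRatio, deriv_deriv_lineRatio]
  ring

lemma continuousOn_deriv_deriv_lineRatio {g g' : ℝ → HermitianMetric n X}
    (hg : IsChernRicciFlow g) (hg' : IsChernRicciFlow g') (p : X) (U : Cn n) :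
    ContinuousOn (fun s => deriv (deriv fun x => lineRatio g g' p U (s, x)) 0) (Ici 0) := by
  obtain ⟨ε, hε, h⟩ := exists_line_mem_target p U
  exact (second_deriv_test_average ⟨neg_lt_zero.mpr hε, hε⟩ (contDiffOn_lineRatio hg hg' h)).1

/-- The integrated form of the difference of the two flow equations. -/
lemma form_sub_form_eq_integral {g g' : ℝ → HermitianMetric n X}
    (hg : IsChernRicciFlow g) (hg' : IsChernRicciFlow g') (p : X)
    (V : TangentSpace 𝓘(ℂ, Cn n) p) {t : ℝ} (ht : 0 ≤ t) :
    ∫ s in (0 : ℝ)..t, Real.exp s * ((chernRicci (g' s) p V V).re - (chernRicci (g s) p V V).re) =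
      Real.exp t * (((g t).form p V V).re - ((g' t).form p V V).re) -
        (((g 0).form p V V).re - ((g' 0).form p V V).re) := by
  have hcont : ∀ {h : ℝ → HermitianMetric n X}, IsChernRicciFlow h →
      ContinuousOn (fun s => ((h s).form p V V).re) (Icc 0 t) := fun hh s hs =>
    (Complex.continuous_re.continuousAt.comp_continuousWithinAt
      (hh.flow s hs.1 p V V).continuousWithinAt).mono Icc_subset_Ici_self
  have hric : ContinuousOn
      (fun s => (chernRicci (g' s) p V V).re - (chernRicci (g s) p V V).re) (Ici 0) := by
    simp only [ricci_sub_ricci]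
    exact ((continuousOn_deriv_deriv_lineRatio hg hg' p _).add
      (continuousOn_deriv_deriv_lineRatio hg hg' p _)).const_smul (1 / 4 : ℝ)
  have := intervalIntegral.integral_eq_sub_of_hasDeriv_right_of_le ht
    (f := fun s => Real.exp s * (((g s).form p V V).re - ((g' s).form p V V).re))
    (f' := fun s => Real.exp s * ((chernRicci (g' s) p V V).re - (chernRicci (g s) p V V).re))
    (Real.continuous_exp.continuousOn.mul ((hcont hg).sub (hcont hg')))
    (fun s hs => by
      -- The weight eˢ cancels the zeroth-order term of the flow: (eˢω)' = -eˢ Ric(ω).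
      have h1 := (Real.hasDerivAt_exp s).mul
        ((hasDerivAt_form_re hg hs.1 p V).sub (hasDerivAt_form_re hg' hs.1 p V))
      refine (h1.congr_deriv ?_).hasDerivWithinAt
      simp only [Pi.sub_apply]
      ring)
    (intervalIntegrable_of_continuousOn_Ici (Real.continuous_exp.continuousOn.mul hric) ht)
  simpa using this

/-- The second-order condition at a spatial maximum of a combination of the logarithmic volume
ratio and the potential, using `√-1 ∂∂̄ log (ωⁿ/ω̃ⁿ) = Ric(ω̃) - Ric(ω)` and
`√-1 ∂∂̄ v = ω - ω̃ - e^{-t} (ω₀ - ω̃₀)`. -/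
lemma form_nonpos_of_isMax {g g' : ℝ → HermitianMetric n X}
    (hg : IsChernRicciFlow g) (hg' : IsChernRicciFlow g') {t : ℝ} (ht : 0 ≤ t) {p : X} {α β : ℝ}
    (hmax : ∀ q, α * logRatio g g' q t + β * potential g g' q t ≤
      α * logRatio g g' p t + β * potential g g' p t) (V : TangentSpace 𝓘(ℂ, Cn n) p) :
    α * ((chernRicci (g' t) p V V).re - (chernRicci (g t) p V V).re) +
      β * (((g t).form p V V).re - ((g' t).form p V V).re -
        Real.exp (-t) * (((g 0).form p V V).re - ((g' 0).form p V V).re)) ≤ 0 := by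
  -- Test the maximum along the line in direction `U`; the factor e^{-t} of the potential is
  -- constant in space and joins `β`.
  have key : ∀ U : Cn n, α * deriv (deriv fun x => lineRatio g g' p U (t, x)) 0 +
      β * Real.exp (-t) * ∫ s in (0 : ℝ)..t,
        Real.exp s * deriv (deriv fun x => lineRatio g g' p U (s, x)) 0 ≤ 0 := by
    intro U
    obtain ⟨ε, hε, h⟩ := exists_line_mem_target p U
    have hmem : (0 : ℝ) ∈ Ioo (-ε) ε := ⟨neg_lt_zero.mpr hε, hε⟩
    refine (second_deriv_test_average hmem (contDiffOn_lineRatio hg hg' h)).2 t ht _ _ ?_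
    have hval : ∀ x ∈ Ioo (-ε) ε, α * lineRatio g g' p U (t, x) + β * Real.exp (-t) *
        ∫ s in (0 : ℝ)..t, Real.exp s * lineRatio g g' p U (s, x) =
        α * logRatio g g' ((chartAt (Cn n) p).symm (chartAt (Cn n) p p + x • U)) t +
        β * potential g g' ((chartAt (Cn n) p).symm (chartAt (Cn n) p p + x • U)) t := by
      intro x hx
      have : ∀ s, lineRatio g g' p U (s, x) =
          logRatio g g' ((chartAt (Cn n) p).symm (chartAt (Cn n) p p + x • U)) s := fun s => by
        rw [logRatio, log_volRatio_eq _ _ (chart_mem_atlas _ p)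
          ((chartAt (Cn n) p).map_target (h x hx)), (chartAt (Cn n) p).right_inv (h x hx)]
        rfl
      simp only [this, potential, logRatio, mul_assoc]
    filter_upwards [Ioo_mem_nhds hmem.1 hmem.2] with x hx
    rw [hval x hx, hval 0 hmem]
    simp only [zero_smul, add_zero, (chartAt (Cn n) p).left_inv (mem_chart_source (Cn n) p)]
    exact hmax _
  have hI : ∀ U : Cn n, IntervalIntegrable
      (fun s => Real.exp s * deriv (deriv fun x => lineRatio g g' p U (s, x)) 0) volume 0 t :=
    fun U => intervalIntegrable_of_continuousOn_Ici
      (Real.continuous_exp.continuousOn.mul (continuousOn_deriv_deriv_lineRatio hg hg' p U)) ht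
  have hform := form_sub_form_eq_integral hg hg' p V ht
  -- The conditions along U and √-1U, added and divided by four, give the Levi form on `V`.
  have h1 := key (chartDiff (chartAt (Cn n) p) p V)
  have h2 := key (Complex.I • chartDiff (chartAt (Cn n) p) p V)
  simp only [ricci_sub_ricci] at hform ⊢
  have hsplit : ∀ a b : ℝ → ℝ, ∀ s, Real.exp s * (1 / 4 * (a s + b s)) =
      (1 / 4) * (Real.exp s * a s + Real.exp s * b s) := fun a b s => by ring
  rw [intervalIntegral.integral_congr fun s _ => hsplit
    (fun s => deriv (deriv fun x =>
          lineRatio g g' p (chartDiff (chartAt (Cn n) p) p V) (s, x)) 0)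
    (fun s => deriv (deriv fun x =>
          lineRatio g g' p (Complex.I • chartDiff (chartAt (Cn n) p) p V) (s, x)) 0) s,
    intervalIntegral.integral_const_mul, intervalIntegral.integral_add (hI _) (hI _)] at hform
  have hexp : Real.exp (-t) * Real.exp t = 1 := by rw [← Real.exp_add]; simp
  have h3 := congrArg (fun y => Real.exp (-t) * y) hform
  simp only [mul_sub (Real.exp (-t)) (Real.exp t * _), ← mul_assoc, hexp, one_mul] at h3
  rw [← h3]
  linarith

end MaximumTest

/-! ### The potential and its time derivative -/

section Potential

open Filter Topology MeasureTheory

variable {n : ℕ} {X : Type*} [TopologicalSpace X] [ChartedSpace (Cn n) X]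

/-- Freezing the integrand's log ratio at its value at time 0 for s < 0 makes it continuous for all
real `s`, so joint continuity and the fundamental theorem of calculus apply up to t = 0. -/
lemma potential_eq (g g' : ℝ → HermitianMetric n X) (p : X) {t : ℝ} (ht : 0 ≤ t) :
    potential g g' p t =
      Real.exp (-t) * ∫ s in (0 : ℝ)..t, Real.exp s * logRatio g g' p (max s 0) := by
  rw [potential]
  congr 1
  refine intervalIntegral.integral_congr fun s hs => ?_
  rw [uIcc_of_le ht] at hs
  simp only [max_eq_left hs.1, logRatio]

variable [IsManifold 𝓘(ℂ, Cn n) ω X] {g g' : ℝ → HermitianMetric n X}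

lemma continuous_logRatio_max (hg : IsChernRicciFlow g) (hg' : IsChernRicciFlow g') :
    Continuous fun y : X × ℝ => logRatio g g' y.1 (max y.2 0) :=
  (continuousOn_logRatio hg hg').comp_continuous
    (f := fun y : X × ℝ => (y.1, max y.2 0)) (by fun_prop) fun y => ⟨mem_univ _, mem_Ici.mpr (le_max_right _ _)⟩

lemma continuousOn_potential (hg : IsChernRicciFlow g) (hg' : IsChernRicciFlow g') :
    ContinuousOn (fun y : X × ℝ => potential g g' y.1 y.2) (univ ×ˢ Ici 0) := by
  have hF : Continuous (Function.uncurry fun (y : X × ℝ) (s : ℝ) =>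
      Real.exp s * logRatio g g' y.1 (max s 0)) :=
    (Real.continuous_exp.comp continuous_snd).mul ((continuous_logRatio_max hg hg').comp
      (f := fun y : (X × ℝ) × ℝ => (y.1.1, y.2)) (by fun_prop))
  have h := intervalIntegral.continuous_parametric_intervalIntegral_of_continuous (μ := volume)
    (a₀ := 0) hF continuous_snd
  have h2 : Continuous fun y : X × ℝ => Real.exp (-y.2) *
      ∫ s in (0 : ℝ)..y.2, Real.exp s * logRatio g g' y.1 (max s 0) :=
    (Real.continuous_exp.comp continuous_snd.neg).mul h
  exact h2.continuousOn.congr fun y hy => potential_eq g g' y.1 hy.2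

lemma hasDerivWithinAt_potential (hg : IsChernRicciFlow g) (hg' : IsChernRicciFlow g') (p : X)
    {t : ℝ} (ht : 0 ≤ t) :
    HasDerivWithinAt (potential g g' p) (logRatio g g' p t - potential g g' p t) (Ici 0) t := by
  have hc : Continuous fun s => Real.exp s * logRatio g g' p (max s 0) :=
    Real.continuous_exp.mul ((continuous_logRatio_max hg hg').comp
      (f := fun s : ℝ => (p, s)) (by fun_prop))
  have h1 := (hasDerivAt_neg t).exp.mul (hc.integral_hasStrictDerivAt 0 t).hasDerivAt
  have h2 : HasDerivAt (fun t => Real.exp (-t) *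
      ∫ s in (0 : ℝ)..t, Real.exp s * logRatio g g' p (max s 0))
      (logRatio g g' p t - potential g g' p t) t := by
    refine h1.congr_deriv ?_
    have hexp : Real.exp (-t) * Real.exp t = 1 := by rw [← Real.exp_add]; simp
    rw [potential_eq g g' p ht, max_eq_left ht, ← mul_assoc, hexp]
    ring
  exact h2.hasDerivWithinAt.congr (fun s hs => potential_eq g g' p hs) (potential_eq g g' p ht)

lemma logRatio_eq (g g' : ℝ → HermitianMetric n X) (p : X) (s : ℝ) :
    logRatio g g' p s = logDet (g s) (chartAt (Cn n) p) (chartAt (Cn n) p p) -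
      logDet (g' s) (chartAt (Cn n) p) (chartAt (Cn n) p p) :=
  log_volRatio_eq _ _ (chart_mem_atlas _ p) (mem_chart_source _ p)

/-- Turns the sign of the potential for exchanged flows into an upper bound. -/
lemma potential_swap (g g' : ℝ → HermitianMetric n X) (p : X) (t : ℝ) :
    potential g' g p t = -potential g g' p t := by
  have h : ∀ s, Real.log (volRatio (g' s) (g s) p) = -Real.log (volRatio (g s) (g' s) p) :=
    fun s => by
      have h1 := logRatio_eq g g' p s
      have h2 := logRatio_eq g' g p s
      rw [logRatio] at h1 h2
      rw [h1, h2]; ring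
  simp only [potential, h, mul_neg, intervalIntegral.integral_neg]

/-- If the logarithmic volume ratios of two pairs of families are at bounded distance, so are the
potentials. -/
lemma abs_potential_sub_le {g₁ g₁' : ℝ → HermitianMetric n X} (hg : IsChernRicciFlow g)
    (hg' : IsChernRicciFlow g') (hg₁ : IsChernRicciFlow g₁) (hg₁' : IsChernRicciFlow g₁') {p : X}
    {K : ℝ} (hK : ∀ s, 0 ≤ s → |logRatio g g' p s - logRatio g₁ g₁' p s| ≤ K) {t : ℝ}
    (ht : 0 ≤ t) : |potential g g' p t - potential g₁ g₁' p t| ≤ K := by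
  have hI : ∀ {h h' : ℝ → HermitianMetric n X}, IsChernRicciFlow h → IsChernRicciFlow h' →
      IntervalIntegrable (fun s => Real.exp s * Real.log (volRatio (h s) (h' s) p)) volume 0 t :=
    fun hh hh' => intervalIntegrable_of_continuousOn_Ici
      (Real.continuous_exp.continuousOn.mul (continuousOn_logRatio_right hh hh' p)) ht
  have hK0 : 0 ≤ K := (abs_nonneg _).trans (hK 0 le_rfl)
  have hexp : Real.exp (-t) * Real.exp t = 1 := by rw [← Real.exp_add]; simp
  rw [potential, potential, ← mul_sub, ← intervalIntegral.integral_sub (hI hg hg') (hI hg₁ hg₁'),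
    abs_mul, abs_of_pos (Real.exp_pos _)]
  have hb : |∫ s in (0 : ℝ)..t, (Real.exp s * Real.log (volRatio (g s) (g' s) p) -
      Real.exp s * Real.log (volRatio (g₁ s) (g₁' s) p))| ≤
      ∫ s in (0 : ℝ)..t, Real.exp s * K := by
    rw [← Real.norm_eq_abs]
    refine intervalIntegral.norm_integral_le_of_norm_le ht ?_
      ((Real.continuous_exp.mul continuous_const).intervalIntegrable _ _)
    refine Eventually.of_forall fun s hs => ?_
    rw [← mul_sub, Real.norm_eq_abs, abs_mul, abs_of_pos (Real.exp_pos _)]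
    exact mul_le_mul_of_nonneg_left (hK s hs.1.le) (Real.exp_pos _).le
  -- The weight e^{s-t} has total mass 1 - e^{-t} ≤ 1 on [0, t].
  rw [intervalIntegral.integral_mul_const, integral_exp, Real.exp_zero] at hb
  calc Real.exp (-t) * _ ≤ Real.exp (-t) * ((Real.exp t - 1) * K) :=
        mul_le_mul_of_nonneg_left hb (Real.exp_pos _).le
    _ = K - Real.exp (-t) * K := by linear_combination K * hexp
    _ ≤ K := by have := mul_nonneg (Real.exp_pos (-t)).le hK0; linarith

end Potential

section MaximumPrinciple

open Filter Topology

lemma nonneg_deriv_of_max {φ : ℝ → ℝ} {d t : ℝ} (ht : 0 < t)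
    (hd : HasDerivWithinAt φ d (Ici 0) t) (hmax : ∀ s ∈ Icc 0 t, φ s ≤ φ t) : 0 ≤ d := by
  have h := (hasDerivAt_iff_tendsto_slope.mp (hd.hasDerivAt (Ici_mem_nhds ht))).mono_left
    (nhdsWithin_mono t fun s (hs : s ∈ Iio t) => ne_of_lt hs)
  refine ge_of_tendsto h ?_
  filter_upwards [Ioo_mem_nhdsLT ht] with s hs
  rw [slope_def_field]
  exact div_nonneg_of_nonpos (sub_nonpos.mpr (hmax s ⟨hs.1.le, hs.2.le⟩))
    (sub_nonpos.mpr hs.2.le)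

/-- A maximum over the compact set X × [0, t] lies either at time 0 or at a positive time s, where
it is maximal over X and over the past [0, s]. -/
lemma le_of_forall_max {X : Type*} [TopologicalSpace X] [CompactSpace X] {f : X → ℝ → ℝ} {K : ℝ}
    (hf : ContinuousOn (fun y : X × ℝ => f y.1 y.2) (univ ×ˢ Ici 0)) (h0 : ∀ p, f p 0 ≤ K)
    (hmax : ∀ p t, 0 < t → (∀ q, f q t ≤ f p t) → (∀ s ∈ Icc 0 t, f p s ≤ f p t) → f p t ≤ K)
    (p : X) {t : ℝ} (ht : 0 ≤ t) : f p t ≤ K := by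
  have hcpt : IsCompact ((univ : Set X) ×ˢ Icc (0 : ℝ) t) := isCompact_univ.prod isCompact_Icc
  obtain ⟨⟨q, s⟩, hqs, hm⟩ := hcpt.exists_isMaxOn ⟨(p, t), mem_univ _, ht, le_rfl⟩
    (hf.mono (prod_mono_right Icc_subset_Ici_self))
  have hm' : ∀ q' s', s' ∈ Icc 0 t → f q' s' ≤ f q s := fun q' s' hs' =>
    hm (show (q', s') ∈ (univ : Set X) ×ˢ Icc (0 : ℝ) t from ⟨mem_univ _, hs'⟩)
  refine (hm' p t ⟨ht, le_rfl⟩).trans ?_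
  rcases hqs.2.1.eq_or_lt with h | h
  · rw [← show (0 : ℝ) = s from h]; exact h0 q
  · exact hmax q s h (fun q' => hm' q' s hqs.2)
      fun s' hs' => hm' q s' ⟨hs'.1, hs'.2.trans hqs.2.2⟩

end MaximumPrinciple

/-! ### Constant multiples of a metric -/

section Scaling

variable {n : ℕ} {X : Type*} [TopologicalSpace X] [ChartedSpace (Cn n) X]

/-- A positive multiple of a Hermitian metric. -/
def HermitianMetric.smul (c : ℝ) (hc : 0 < c) (g : HermitianMetric n X) : HermitianMetric n X where
  form := fun p => (c : ℂ) • g.form p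
  hermitian p V W := by
    simp only [LinearMap.smul_apply, smul_eq_mul, map_mul, Complex.conj_ofReal, g.hermitian p V W]
  pos p V hV := by
    simp only [LinearMap.smul_apply, smul_eq_mul, Complex.re_ofReal_mul]
    exact mul_pos hc (g.pos p V hV)
  smooth e he i j := contDiffOn_const.mul (g.smooth e he i j)

lemma HermitianMetric.smul_form_re (c : ℝ) (hc : 0 < c) (g : HermitianMetric n X) (p : X)
    (V : TangentSpace 𝓘(ℂ, Cn n) p) :
    ((g.smul c hc).form p V V).re = c * (g.form p V V).re :=
  Complex.re_ofReal_mul _ _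

lemma logDet_smul [IsManifold 𝓘(ℂ, Cn n) ω X] (c : ℝ) (hc : 0 < c) (g : HermitianMetric n X)
    {e : OpenPartialHomeomorph X (Cn n)} (he : e ∈ atlas (Cn n) X) {z : Cn n} (hz : z ∈ e.target) :
    logDet (g.smul c hc) e z = n * Real.log c + logDet g e z := by
  have h1 : (g.smul c hc).form.comp e (e.symm z) = (c : ℂ) • g.form.comp e (e.symm z) := rfl
  have h2 := comp_det_pos g he (e.map_target hz)
  rw [logDet, logDet, h1, Matrix.det_smul, Fintype.card_fin, ← Complex.ofReal_pow,
    Complex.re_ofReal_mul, Real.log_mul (pow_pos hc n).ne' h2.ne', Real.log_pow]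

end Scaling

/-! ### Estimates for ordered initial metrics -/

section Comparison

variable {n : ℕ} {X : Type*} [TopologicalSpace X] [CompactSpace X] [ChartedSpace (Cn n) X]
  [IsManifold 𝓘(ℂ, Cn n) ω X] {g g' : ℝ → HermitianMetric n X}

/-- If the initial metrics are ordered, the potential has a sign. -/
lemma potential_nonneg (hg : IsChernRicciFlow g) (hg' : IsChernRicciFlow g')
    (h0 : ∀ p V, ((g' 0).form p V V).re ≤ ((g 0).form p V V).re) (p : X) {t : ℝ} (ht : 0 ≤ t) :
    0 ≤ potential g g' p t := by
  have := le_of_forall_max (f := fun p t => -potential g g' p t) (K := 0)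
    (continuousOn_potential hg hg').neg (fun p => by simp [potential]) ?_ p ht
  · simpa using this
  intro p t ht hsp htm
  have hd := nonneg_deriv_of_max ht (hasDerivWithinAt_potential hg hg' p ht.le).fun_neg htm
  have hle : ∀ V, ((g' t).form p V V).re ≤ ((g t).form p V V).re := by
    intro V
    have h1 := form_nonpos_of_isMax hg hg' ht.le (p := p) (α := 0) (β := -1)
      (fun q => by have := hsp q; linarith) V
    have h2 := mul_nonneg (Real.exp_pos (-t)).le (sub_nonneg.mpr (h0 p V))
    linarith
  -- From ω̃ ≤ ω the frame inequality gives log(ωⁿ/ω̃ⁿ) ≥ 0, and `hd` says that the potential is at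
  -- least this logarithm.
  obtain ⟨v, hv, hv'⟩ := (g t).exists_isFrame p
  have h1 := hv' (g' t)
  have h2 : ∑ k, ((g' t).form p (v k) (v k)).re ≤ n := by
    rw [← hv]; exact Finset.sum_le_sum fun k _ => hle (v k)
  have h3 := logRatio_eq g g' p t
  linarith

/-- The logarithmic volume ratio is controlled by the potential when the initial metrics are
ordered and the Ricci curvature of the smaller flow is bounded. -/
lemma exists_abs_logRatio_le (hg : IsChernRicciFlow g) (hg' : IsChernRicciFlow g')
    (h0 : ∀ p V, ((g' 0).form p V V).re ≤ ((g 0).form p V V).re) {C : ℝ} (hC : 0 ≤ C)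
    (hRic : ∀ t, 0 ≤ t → ∀ p V,
      |(chernRicci (g' t) p V V).re| ≤ C * ((g' t).form p V V).re) :
    ∃ K, ∀ p t, 0 ≤ t → |logRatio g g' p t| ≤ (C + 1) * potential g g' p t + K := by
  obtain ⟨K₀, hK₀⟩ : ∃ K₀, ∀ p, |logRatio g g' p 0| ≤ K₀ := by
    have hc : Continuous fun p => logRatio g g' p 0 :=
      (continuousOn_logRatio hg hg').comp_continuous (f := fun p => (p, (0 : ℝ))) (by fun_prop)
        fun p => ⟨mem_univ _, mem_Ici.mpr le_rfl⟩
    obtain ⟨K₀, h⟩ := isCompact_univ.exists_bound_of_continuousOn hc.continuousOn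
    exact ⟨K₀, fun p => h p (mem_univ p)⟩
  -- C absorbs Ric(ω̃); the extra 1 leaves a term -ω̃ for the lower bound.
  set A := C + 1 with hA
  have hn : (0 : ℝ) ≤ n := n.cast_nonneg
  have hdt : ∀ p t, 0 < t → ∀ v u, (g t).IsFrame p v → (g' t).IsFrame p u →
      HasDerivWithinAt (logRatio g g' p) (∑ k, (chernRicci (g' t) p (u k) (u k)).re -
        ∑ k, (chernRicci (g t) p (v k) (v k)).re) (Ici 0) t := by
    intro p t ht v u hv hu
    have h1 := ((hasDerivAt_logDet hg ht hv).sub (hasDerivAt_logDet hg' ht hu)).hasDerivWithinAt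
      (s := Ici 0)
    have h2 := h1.congr (f₁ := logRatio g g' p) (fun s _ => logRatio_eq g g' p s)
      (logRatio_eq g g' p t)
    exact h2.congr_deriv (by ring)
  have htr : ∀ p t, 0 < t → ∀ u, (g' t).IsFrame p u →
      |∑ k, (chernRicci (g' t) p (u k) (u k)).re| ≤ C * n := by
    intro p t ht u hu
    refine (Finset.abs_sum_le_sum_abs _ _).trans ?_
    rw [← hu.1, Finset.mul_sum]
    exact Finset.sum_le_sum fun k _ => hRic t ht.le p (u k)
  have hcont : ∀ α β : ℝ, ContinuousOn
      (fun y : X × ℝ => α * logRatio g g' y.1 y.2 + β * potential g g' y.1 y.2)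
      (univ ×ˢ Ici 0) := fun α β =>
    (continuousOn_const.mul (continuousOn_logRatio hg hg')).add
      (continuousOn_const.mul (continuousOn_potential hg hg'))
  have hpot0 : ∀ p, potential g g' p 0 = 0 := fun p => by simp [potential]
  have hord : ∀ p t V, 0 ≤ A * (Real.exp (-t) * (((g 0).form p V V).re - ((g' 0).form p V V).re)) :=
    fun p t V => mul_nonneg (by positivity)
      (mul_nonneg (Real.exp_pos (-t)).le (sub_nonneg.mpr (h0 p V)))
  -- The constant left over in the lower bound, once (C + A)n is enlarged to 2An.
  set K₁ := 2 * A * n - (A + 1) * (n - n * Real.log (A + 1)) with hK₁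
  have hup : ∀ p t, 0 ≤ t → 1 * logRatio g g' p t + (-A) * potential g g' p t ≤ max K₀ (2 * n) := by
    intro p t ht
    refine le_of_forall_max (f := fun p t => 1 * logRatio g g' p t + (-A) * potential g g' p t)
      (hcont 1 (-A)) (fun p => ?_) (fun p t ht hsp htm => ?_) p ht
    · rw [hpot0]
      have := (le_abs_self _).trans (hK₀ p)
      have h2 := le_max_left K₀ (2 * n)
      linarith
    obtain ⟨v, hv⟩ := (g t).exists_isFrame p
    obtain ⟨u, hu⟩ := (g' t).exists_isFrame p
    have hd := nonneg_deriv_of_max ht (((hdt p t ht v u hv hu).const_mul 1).add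
      ((hasDerivWithinAt_potential hg hg' p ht.le).const_mul (-A))) htm
    -- The second-order condition bounds -Ric(ω) by Aω - Aω̃ - Ric(ω̃), and the last two terms are
    -- together nonpositive.
    have hV : ∀ V, -(chernRicci (g t) p V V).re ≤ A * ((g t).form p V V).re := by
      intro V
      have h1 := form_nonpos_of_isMax hg hg' ht.le hsp V
      have h2 := (abs_le.mp (hRic t ht.le p V)).1
      have h3 := hord p t V
      have h4 : 0 ≤ ((g' t).form p V V).re := by
        rcases eq_or_ne V 0 with rfl | h
        · simp
        · exact ((g' t).pos p V h).le
      rw [hA] at *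
      linarith
    have hsum : -∑ k, (chernRicci (g t) p (v k) (v k)).re ≤ A * n := by
      rw [← Finset.sum_neg_distrib, ← hv.1, Finset.mul_sum]
      exact Finset.sum_le_sum fun k _ => hV (v k)
    have h5 := (abs_le.mp (htr p t ht u hu)).2
    have hpos := potential_nonneg hg hg' h0 p ht.le
    -- The time derivative at the maximum gives A(w - v) ≤ (C + A)n; then w - Av = (w - v) - Cv is
    -- at most 2n because v ≥ 0.
    have hw : logRatio g g' p t - potential g g' p t ≤ 2 * n := by
      have hA0 : 0 < A := by positivity
      have : A * (logRatio g g' p t - potential g g' p t) ≤ A * (2 * n) := by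
        rw [hA] at *
        linarith
      exact le_of_mul_le_mul_left this hA0
    have h6 := le_max_right K₀ (2 * n)
    have h7 := mul_nonneg hC hpos
    rw [hA]
    linarith
  have hlow : ∀ p t, 0 ≤ t → (-1) * logRatio g g' p t + (-A) * potential g g' p t ≤ max K₀ K₁ := by
    intro p t ht
    refine le_of_forall_max (f := fun p t => (-1) * logRatio g g' p t + (-A) * potential g g' p t)
      (hcont (-1) (-A)) (fun p => ?_) (fun p t ht hsp htm => ?_) p ht
    · rw [hpot0]
      have := (neg_le_abs _).trans (hK₀ p)
      have h2 := le_max_left K₀ K₁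
      linarith
    obtain ⟨v, hv⟩ := (g t).exists_isFrame p
    obtain ⟨u, hu⟩ := (g' t).exists_isFrame p
    have hd := nonneg_deriv_of_max ht (((hdt p t ht v u hv hu).const_mul (-1)).add
      ((hasDerivWithinAt_potential hg hg' p ht.le).const_mul (-A))) htm
    have hV : ∀ V, (chernRicci (g t) p V V).re ≤
        A * ((g t).form p V V).re - ((g' t).form p V V).re := by
      intro V
      have h1 := form_nonpos_of_isMax hg hg' ht.le hsp V
      have h2 := (abs_le.mp (hRic t ht.le p V)).2
      have h3 := hord p t V
      rw [hA] at *
      linarith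
    have hsum : ∑ k, (chernRicci (g t) p (v k) (v k)).re ≤
        A * n - ∑ k, ((g' t).form p (v k) (v k)).re := by
      rw [← hv.1, Finset.mul_sum, ← Finset.sum_sub_distrib]
      exact Finset.sum_le_sum fun k _ => hV (v k)
    have h5 := (abs_le.mp (htr p t ht u hu)).1
    have hA1 : 0 < A + 1 := by positivity
    -- Scaling by 1/(A+1) before using concavity gives tr_ω ω̃ ≥ -(A+1)w + const. Against the term
    -- -Aw from the derivative of -Av, exactly +w survives, so 0 ≤ K₁ + w + Av.
    have hf := hv.2 ((g' t).smul (A + 1)⁻¹ (inv_pos.mpr hA1))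
    simp only [HermitianMetric.smul_form_re, ← Finset.mul_sum] at hf
    rw [logDet_smul _ _ _ (chart_mem_atlas _ p) (mem_chart_target _ p), Real.log_inv] at hf
    have hS : (A + 1) * (n - n * Real.log (A + 1) - logRatio g g' p t) ≤
        ∑ k, ((g' t).form p (v k) (v k)).re := by
      rw [← le_inv_mul_iff₀ hA1, logRatio_eq]
      linarith
    have h6 := le_max_right K₀ K₁
    have h7 : C * n ≤ A * n := by rw [hA]; linarith
    linarith
  refine ⟨max (max K₀ (2 * n)) (max K₀ K₁), fun p t ht => abs_le.mpr ⟨?_, ?_⟩⟩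
  · have := hlow p t ht
    have h2 := le_max_right (max K₀ (2 * (n : ℝ))) (max K₀ K₁)
    linarith
  · have := hup p t ht
    have h2 := le_max_left (max K₀ (2 * (n : ℝ))) (max K₀ K₁)
    linarith

end Comparison

/-! ### The scaling symmetry of the normalised flow -/

section Rescaling

open Filter Topology

variable {n : ℕ} {X : Type*} [TopologicalSpace X] [ChartedSpace (Cn n) X]

/-- The conformal factor of the rescaled normalised flow. -/
def rescaleFactor (l t : ℝ) : ℝ := 1 - (1 - l) * Real.exp (-t)

/-- The time change of the rescaled normalised flow. -/
def rescaleTime (l t : ℝ) : ℝ := Real.log ((Real.exp t - 1 + l) / l)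

lemma min_le_rescaleFactor {l t : ℝ} (ht : 0 ≤ t) : min 1 l ≤ rescaleFactor l t := by
  have h1 := Real.exp_pos (-t)
  have h2 : Real.exp (-t) ≤ 1 := Real.exp_le_one_iff.mpr (neg_nonpos.mpr ht)
  rw [rescaleFactor]
  rcases le_total 1 l with h | h
  · rw [min_eq_left h]; nlinarith
  · rw [min_eq_right h]; nlinarith

lemma rescaleFactor_le_max {l t : ℝ} (ht : 0 ≤ t) : rescaleFactor l t ≤ max 1 l := by
  have h1 := Real.exp_pos (-t)
  have h2 : Real.exp (-t) ≤ 1 := Real.exp_le_one_iff.mpr (neg_nonpos.mpr ht)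
  rw [rescaleFactor]
  rcases le_total 1 l with h | h
  · rw [max_eq_right h]; nlinarith
  · rw [max_eq_left h]; nlinarith

lemma rescaleFactor_pos {l t : ℝ} (hl : 0 < l) (ht : 0 ≤ t) : 0 < rescaleFactor l t :=
  (lt_min one_pos hl).trans_le (min_le_rescaleFactor ht)

lemma abs_log_rescaleFactor_le {l t : ℝ} (hl : 0 < l) (ht : 0 ≤ t) :
    |Real.log (rescaleFactor l t)| ≤ |Real.log l| := by
  have h1 := Real.log_le_log (lt_min one_pos hl) (min_le_rescaleFactor ht)
  have h2 := Real.log_le_log (rescaleFactor_pos hl ht) (rescaleFactor_le_max ht)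
  rcases le_total 1 l with h | h
  · rw [min_eq_left h, Real.log_one] at h1
    rw [max_eq_right h] at h2
    rw [abs_of_nonneg h1]
    exact h2.trans (le_abs_self _)
  · rw [min_eq_right h] at h1
    rw [max_eq_left h, Real.log_one] at h2
    rw [abs_of_nonpos h2]
    exact (neg_le_neg h1).trans (neg_le_abs _)

lemma exp_sub_one_add_pos {l t : ℝ} (hl : 0 < l) (ht : 0 ≤ t) : 0 < Real.exp t - 1 + l := by
  have := Real.one_le_exp ht
  linarith

lemma rescaleTime_nonneg {l t : ℝ} (hl : 0 < l) (ht : 0 ≤ t) : 0 ≤ rescaleTime l t := by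
  refine Real.log_nonneg ?_
  rw [le_div_iff₀ hl]
  have := Real.one_le_exp ht
  linarith

lemma rescaleFactor_eq (l t : ℝ) :
    rescaleFactor l t = Real.exp (-t) * (Real.exp t - 1 + l) := by
  have hexp : Real.exp (-t) * Real.exp t = 1 := by rw [← Real.exp_add]; simp
  rw [rescaleFactor]
  linear_combination -hexp

lemma abs_rescaleTime_sub_le {l t : ℝ} (hl : 0 < l) (ht : 0 ≤ t) :
    |rescaleTime l t - t| ≤ 2 * |Real.log l| := by
  have hpos := exp_sub_one_add_pos hl ht
  -- The time shift is a difference of logarithms, each at most |log l| in size.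
  have h : rescaleTime l t - t = Real.log (rescaleFactor l t) - Real.log l := by
    rw [rescaleFactor_eq, Real.log_mul (Real.exp_pos _).ne' hpos.ne', Real.log_exp, rescaleTime,
      Real.log_div hpos.ne' hl.ne']
    ring
  rw [h]
  calc _ ≤ |Real.log (rescaleFactor l t)| + |Real.log l| := abs_sub _ _
    _ ≤ _ := by have := abs_log_rescaleFactor_le hl ht; linarith

lemma hasDerivAt_rescaleFactor (l t : ℝ) :
    HasDerivAt (rescaleFactor l) (1 - rescaleFactor l t) t := by
  have h := (((hasDerivAt_neg t).exp).const_mul (1 - l)).const_sub 1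
  refine h.congr_deriv ?_
  rw [rescaleFactor]; ring

lemma hasDerivAt_rescaleTime {l t : ℝ} (hl : 0 < l) (ht : 0 ≤ t) :
    HasDerivAt (rescaleTime l) (rescaleFactor l t)⁻¹ t := by
  have hpos := exp_sub_one_add_pos hl ht
  have h := ((((Real.hasDerivAt_exp t).sub_const 1).add_const l).div_const l).log
    (div_pos hpos hl).ne'
  refine h.congr_deriv ?_
  rw [rescaleFactor_eq, Real.exp_neg]
  have := Real.exp_pos t
  field_simp

/-- A rescaling of the (normalised) flow which multiplies the initial metric by `l`. Negative times
are irrelevant. -/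
def rescale (l : ℝ) (hl : 0 < l) (g : ℝ → HermitianMetric n X) (t : ℝ) : HermitianMetric n X :=
  (g (rescaleTime l (max t 0))).smul (rescaleFactor l (max t 0))
    (rescaleFactor_pos hl (le_max_right _ _))

lemma rescale_form (l : ℝ) (hl : 0 < l) (g : ℝ → HermitianMetric n X) {t : ℝ} (ht : 0 ≤ t) :
    (rescale l hl g t).form =
      fun p => (rescaleFactor l t : ℂ) • (g (rescaleTime l t)).form p := by
  simp only [rescale, HermitianMetric.smul, max_eq_left ht]

lemma rescale_form_re (l : ℝ) (hl : 0 < l) (g : ℝ → HermitianMetric n X) {t : ℝ} (ht : 0 ≤ t)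
    (p : X) (V : TangentSpace 𝓘(ℂ, Cn n) p) :
    ((rescale l hl g t).form p V V).re =
      rescaleFactor l t * ((g (rescaleTime l t)).form p V V).re := by
  rw [rescale_form l hl g ht]
  exact Complex.re_ofReal_mul _ _

variable [IsManifold 𝓘(ℂ, Cn n) ω X]

/-- Scaling adds the constant n log c to log det, which differentiation annihilates. -/
lemma chernRicci_smul (c : ℝ) (hc : 0 < c) (g : HermitianMetric n X) :
    chernRicci (g.smul c hc) = chernRicci g := by
  have key : ∀ (p : X) (i j : Fin n),
      ricciComp (g.smul c hc) (chartAt (Cn n) p) p i j = ricciComp g (chartAt (Cn n) p) p i j := by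
    intro p i j
    have hz : ∀ᶠ y in 𝓝 (chartAt (Cn n) p p),
        dzbar j (fun z => (logDet (g.smul c hc) (chartAt (Cn n) p) z : ℂ)) y =
          dzbar j (fun z => (logDet g (chartAt (Cn n) p) z : ℂ)) y := by
      filter_upwards [(chartAt (Cn n) p).open_target.mem_nhds (mem_chart_target _ p)] with y hy
      have he : (fun z => (logDet (g.smul c hc) (chartAt (Cn n) p) z : ℂ)) =ᶠ[𝓝 y]
          fun z => ((n * Real.log c : ℝ) : ℂ) + (logDet g (chartAt (Cn n) p) z : ℂ) := by
        filter_upwards [(chartAt (Cn n) p).open_target.mem_nhds hy] with z hz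
        rw [logDet_smul c hc g (chart_mem_atlas _ p) hz, Complex.ofReal_add]
      simp only [dzbar, he.fderiv_eq, fderiv_const_add]
    rw [ricciComp, ricciComp, dz, dz, EventuallyEq.fderiv_eq hz]
  funext p
  refine LinearMap.ext₂ fun V W => ?_
  simp only [chernRicci, LinearMap.mk₂'ₛₗ_apply, key]

lemma chernRicci_rescale (l : ℝ) (hl : 0 < l) (g : ℝ → HermitianMetric n X) {t : ℝ} (ht : 0 ≤ t) :
    chernRicci (rescale l hl g t) = chernRicci (g (rescaleTime l t)) := by
  rw [rescale, chernRicci_smul, max_eq_left ht]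

/-- With factor F and time change σ, the identities Fσ' = 1 and F' = 1 - F give (F·g(σ))' = (1 -
F)g(σ) - Ric - g(σ) = -Ric - F·g(σ), and Ric is unchanged by F. -/
lemma IsChernRicciFlow.rescale {g : ℝ → HermitianMetric n X} (hg : IsChernRicciFlow g) {l : ℝ}
    (hl : 0 < l) : IsChernRicciFlow (rescale l hl g) where
  smooth e he i j := by
    have hτ : ContDiffOn ℝ ∞ (fun y : ℝ × Cn n => rescaleTime l y.1) (Ici 0 ×ˢ e.target) := by
      refine ContDiffOn.log (by fun_prop) fun y hy => ?_
      exact (div_pos (exp_sub_one_add_pos hl hy.1) hl).ne'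
    have hc : ContDiffOn ℝ ∞ (fun y : ℝ × Cn n => (rescaleFactor l y.1 : ℂ))
        (Ici 0 ×ˢ e.target) := by
      refine Complex.ofRealCLM.contDiff.comp_contDiffOn ?_
      change ContDiffOn ℝ ∞ (fun y : ℝ × Cn n => 1 - (1 - l) * Real.exp (-y.1)) _
      fun_prop
    have h := (hg.smooth e he i j).comp (hτ.prodMk contDiffOn_snd)
      fun y hy => ⟨rescaleTime_nonneg hl hy.1, hy.2⟩
    refine (hc.mul h).congr fun y hy => ?_
    simp only [Form11.comp, rescale_form l hl g hy.1]
    rfl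
  flow t ht p V W := by
    have h1 := (hg.flow (rescaleTime l t) (rescaleTime_nonneg hl ht) p V W).scomp t
      (hasDerivAt_rescaleTime hl ht).hasDerivWithinAt
      (fun s (hs : s ∈ Ici (0 : ℝ)) => rescaleTime_nonneg hl hs)
    have h2 := ((hasDerivAt_rescaleFactor l t).ofReal_comp.hasDerivWithinAt (s := Ici 0)).mul h1
    have h3 := h2.congr (f₁ := fun s => (ChernRicci.rescale l hl g s).form p V W)
      (fun s hs => by rw [rescale_form l hl g hs]; rfl) (by rw [rescale_form l hl g ht]; rfl)
    refine h3.congr_deriv ?_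
    rw [chernRicci_rescale l hl g ht, rescale_form l hl g ht]
    have hne : (rescaleFactor l t : ℂ) ≠ 0 := by
      exact_mod_cast (rescaleFactor_pos hl ht).ne'
    simp only [Complex.real_smul, LinearMap.smul_apply, smul_eq_mul, Function.comp_apply]
    push_cast
    field_simp
    ring

/-- Bounded Ricci curvature controls the oscillation in time of the volume form. -/
lemma abs_logDet_sub_le {g : ℝ → HermitianMetric n X} (hg : IsChernRicciFlow g) {C : ℝ}
    (hRic : ∀ t, 0 ≤ t → ∀ p V, |(chernRicci (g t) p V V).re| ≤ C * ((g t).form p V V).re)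
    (p : X) {s t : ℝ} (hs : 0 ≤ s) (hst : s ≤ t) :
    |logDet (g t) (chartAt (Cn n) p) (chartAt (Cn n) p p) -
      logDet (g s) (chartAt (Cn n) p) (chartAt (Cn n) p p)| ≤ (C + 1) * n * (t - s) := by
  rcases hst.eq_or_lt with rfl | hlt
  · simp
  have hcont : ContinuousOn (fun s => logDet (g s) (chartAt (Cn n) p) (chartAt (Cn n) p p))
      (Ici 0) :=
    (contDiffOn_logDet hg (chart_mem_atlas _ p)).continuousOn.comp
      (f := fun s : ℝ => (s, chartAt (Cn n) p p)) (by fun_prop)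
      fun s hs => ⟨hs, mem_chart_target _ p⟩
  -- In a frame the derivative of log det is -tr Ric - n, of size at most (C + 1)n; the mean value
  -- theorem then applies.
  choose v hv using fun r => (g r).exists_isFrame p
  obtain ⟨r, hr, hr'⟩ := exists_hasDerivAt_eq_slope _ _ hlt
    (hcont.mono fun r hr => mem_Ici.mpr (hs.trans hr.1))
    fun r hr => hasDerivAt_logDet hg (hs.trans_lt hr.1) (hv r)
  have hpos : 0 < t - s := sub_pos.mpr hlt
  rw [eq_div_iff hpos.ne'] at hr'
  rw [← hr', abs_mul, abs_of_pos hpos]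
  refine mul_le_mul_of_nonneg_right ?_ hpos.le
  have h1 : |∑ k, (chernRicci (g r) p (v r k) (v r k)).re| ≤ C * n := by
    refine (Finset.abs_sum_le_sum_abs _ _).trans ?_
    rw [← (hv r).1, Finset.mul_sum]
    exact Finset.sum_le_sum fun k _ => hRic r (hs.trans hr.1.le) p _
  have hn : (0 : ℝ) ≤ n := n.cast_nonneg
  rw [abs_le] at h1 ⊢
  constructor <;> linarith

/-- Rescaling the second flow changes the logarithmic volume ratio by a bounded amount. -/
lemma abs_logRatio_sub_rescale_le {g' : ℝ → HermitianMetric n X} (g : ℝ → HermitianMetric n X)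
    (hg' : IsChernRicciFlow g') {C : ℝ} (hC : 0 ≤ C)
    (hRic : ∀ t, 0 ≤ t → ∀ p V, |(chernRicci (g' t) p V V).re| ≤ C * ((g' t).form p V V).re)
    {l : ℝ} (hl : 0 < l) (p : X) {t : ℝ} (ht : 0 ≤ t) :
    |logRatio g g' p t - logRatio g (rescale l hl g') p t| ≤
      n * |Real.log l| + (C + 1) * n * (2 * |Real.log l|) := by
  have h1 : logRatio g g' p t - logRatio g (rescale l hl g') p t =
      n * Real.log (rescaleFactor l t) +
        (logDet (g' (rescaleTime l t)) (chartAt (Cn n) p) (chartAt (Cn n) p p) -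
          logDet (g' t) (chartAt (Cn n) p) (chartAt (Cn n) p p)) := by
    rw [logRatio_eq, logRatio_eq, rescale,
      logDet_smul _ _ _ (chart_mem_atlas _ p) (mem_chart_target _ p), max_eq_left ht]
    ring
  have hσ := rescaleTime_nonneg hl ht
  have h2 : |logDet (g' (rescaleTime l t)) (chartAt (Cn n) p) (chartAt (Cn n) p p) -
      logDet (g' t) (chartAt (Cn n) p) (chartAt (Cn n) p p)| ≤
      (C + 1) * n * |rescaleTime l t - t| := by
    rcases le_total t (rescaleTime l t) with h | h
    · rw [abs_of_nonneg (sub_nonneg.mpr h)]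
      exact abs_logDet_sub_le hg' hRic p ht h
    · rw [abs_sub_comm, abs_sub_comm (rescaleTime l t), abs_of_nonneg (sub_nonneg.mpr h)]
      exact abs_logDet_sub_le hg' hRic p hσ h
  rw [h1]
  refine (abs_add_le _ _).trans (add_le_add ?_ (h2.trans ?_))
  · rw [abs_mul, Nat.abs_cast]
    exact mul_le_mul_of_nonneg_left (abs_log_rescaleFactor_le hl ht) n.cast_nonneg
  · exact mul_le_mul_of_nonneg_left (abs_rescaleTime_sub_le hl ht)
      (mul_nonneg (add_nonneg hC zero_le_one) n.cast_nonneg)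

/-- The Ricci form is unchanged while the metric is multiplied by at least min(1, l). -/
lemma abs_chernRicci_rescale_le {g : ℝ → HermitianMetric n X} {C : ℝ}
    (hRic : ∀ t, 0 ≤ t → ∀ p V, |(chernRicci (g t) p V V).re| ≤ C * ((g t).form p V V).re)
    {l : ℝ} (hl : 0 < l) {t : ℝ} (ht : 0 ≤ t) (p : X) (V : TangentSpace 𝓘(ℂ, Cn n) p) :
    |(chernRicci (rescale l hl g t) p V V).re| ≤
      C * (min 1 l)⁻¹ * ((rescale l hl g t).form p V V).re := by
  rw [chernRicci_rescale l hl g ht, rescale_form_re l hl g ht]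
  have h1 := hRic _ (rescaleTime_nonneg hl ht) p V
  have hF : 0 ≤ C * ((g (rescaleTime l t)).form p V V).re := (abs_nonneg _).trans h1
  have hm : 0 < min 1 l := lt_min one_pos hl
  have h2 : 1 ≤ (min 1 l)⁻¹ * rescaleFactor l t := by
    rw [le_inv_mul_iff₀ hm, mul_one]
    exact min_le_rescaleFactor ht
  calc _ ≤ 1 * (C * ((g (rescaleTime l t)).form p V V).re) := by rw [one_mul]; exact h1
    _ ≤ (min 1 l)⁻¹ * rescaleFactor l t * (C * ((g (rescaleTime l t)).form p V V).re) :=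
        mul_le_mul_of_nonneg_right h2 hF
    _ = _ := by ring

end Rescaling

/-! ### Comparability of Hermitian metrics -/

section InitialComparison

open Filter Topology

variable {n : ℕ} {X : Type*} [TopologicalSpace X] [ChartedSpace (Cn n) X]

/-- The quadratic form of a metric in a chart. -/
def chartForm (g : HermitianMetric n X) (e : OpenPartialHomeomorph X (Cn n))
    (y : Cn n × Cn n) : ℝ :=
  (∑ i, ∑ j, y.2 i * conj (y.2 j) * g.form.comp e (e.symm y.1) i j).re

lemma continuousOn_chartForm (g : HermitianMetric n X) {e : OpenPartialHomeomorph X (Cn n)}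
    (he : e ∈ atlas (Cn n) X) : ContinuousOn (chartForm g e) (e.target ×ˢ univ) := by
  refine Complex.continuous_re.comp_continuousOn
    (continuousOn_finsetSum _ fun i _ => continuousOn_finsetSum _ fun j _ => ?_)
  have h1 : ContinuousOn (fun y : Cn n × Cn n => g.form.comp e (e.symm y.1) i j)
      (e.target ×ˢ univ) :=
    (g.smooth e he i j).continuousOn.comp continuousOn_fst fun y hy => hy.1
  have h2 : Continuous fun y : Cn n × Cn n => y.2 i * conj (y.2 j) := by fun_prop
  exact h2.continuousOn.mul h1

variable [IsManifold 𝓘(ℂ, Cn n) ω X]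

lemma form_self_eq_sum (g : HermitianMetric n X) {e : OpenPartialHomeomorph X (Cn n)}
    (he : e ∈ atlas (Cn n) X) {p : X} (hp : p ∈ e.source) (V : TangentSpace 𝓘(ℂ, Cn n) p) :
    g.form p V V = ∑ i, ∑ j, chartDiff e p V i * conj (chartDiff e p V j) * g.form.comp e p i j := by
  have h : g.form p V V = g.form p (∑ i, chartDiff e p V i • chartVec e p i)
      (∑ i, chartDiff e p V i • chartVec e p i) := by
    rw [← (chartVec_linearIndependent he hp).2 V]
  rw [h]
  simp only [map_sum, map_smul, LinearMap.map_smulₛₗ, LinearMap.sum_apply,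
    LinearMap.smul_apply, smul_eq_mul, Finset.mul_sum, Form11.comp, Matrix.of_apply]
  rw [Finset.sum_comm]
  refine Finset.sum_congr rfl fun i _ => Finset.sum_congr rfl fun j _ => by ring

lemma chartForm_eq (g : HermitianMetric n X) {e : OpenPartialHomeomorph X (Cn n)}
    (he : e ∈ atlas (Cn n) X) {p : X} (hp : p ∈ e.source) (V : TangentSpace 𝓘(ℂ, Cn n) p) :
    chartForm g e (e p, chartDiff e p V) = (g.form p V V).re := by
  rw [chartForm, form_self_eq_sum g he hp V]
  simp only [e.left_inv hp]

/-- Any two Hermitian metrics are locally comparable. -/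
lemma exists_local_le (g h : HermitianMetric n X) (p : X) :
    ∃ s ∈ 𝓝 p, ∃ M, ∀ q ∈ s, ∀ V : TangentSpace 𝓘(ℂ, Cn n) q,
      (h.form q V V).re ≤ M * (g.form q V V).re := by
  have he : chartAt (Cn n) p ∈ atlas (Cn n) X := chart_mem_atlas _ p
  set e := chartAt (Cn n) p
  have hp : p ∈ e.source := mem_chart_source _ p
  obtain ⟨δ, hδ, hball⟩ := Metric.nhds_basis_closedBall.mem_iff.mp
    (e.open_target.mem_nhds (e.map_source hp))
  -- By homogeneity it is enough to bound the quotient of the quadratic forms on unit coordinate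
  -- vectors over a closed ball, a compact set.
  have hcpt : IsCompact (Metric.closedBall (e p) δ ×ˢ Metric.sphere (0 : Cn n) 1) :=
    (isCompact_closedBall _ _).prod (isCompact_sphere _ _)
  have hsub : Metric.closedBall (e p) δ ×ˢ Metric.sphere (0 : Cn n) 1 ⊆ e.target ×ˢ univ :=
    fun y hy => ⟨hball hy.1, mem_univ _⟩
  have hpos : ∀ y ∈ Metric.closedBall (e p) δ ×ˢ Metric.sphere (0 : Cn n) 1,
      0 < chartForm g e y := by
    rintro ⟨z, a⟩ ⟨hz, ha⟩
    have hq := e.map_target (hball hz)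
    obtain ⟨V, hV⟩ := exists_chartDiff_eq he hq a
    have hV0 : V ≠ 0 := by
      rintro rfl
      rw [map_zero] at hV
      rw [← hV] at ha
      simp at ha
    have := g.pos _ V hV0
    rwa [← chartForm_eq g he hq, hV, e.right_inv (hball hz)] at this
  obtain ⟨M, hM⟩ := hcpt.exists_bound_of_continuousOn
    (((continuousOn_chartForm h he).mono hsub).div ((continuousOn_chartForm g he).mono hsub)
      fun y hy => (hpos y hy).ne')
  refine ⟨e.source ∩ e ⁻¹' Metric.closedBall (e p) δ,
    inter_mem (e.open_source.mem_nhds hp)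
      ((e.continuousAt hp).preimage_mem_nhds (Metric.closedBall_mem_nhds _ hδ)), M, ?_⟩
  rintro q ⟨hq, hqb⟩ V
  rcases eq_or_ne (chartDiff e q V) 0 with h0 | h0
  · have hV : V = 0 := by
      rw [(chartVec_linearIndependent he hq).2 V, h0]
      simp
    simp [hV]
  · set r := ‖chartDiff e q V‖ with hr
    have hr0 : 0 < r := norm_pos_iff.mpr h0
    have hmem : (e q, chartDiff e q (((r⁻¹ : ℝ) : ℂ) • V)) ∈
        Metric.closedBall (e p) δ ×ˢ Metric.sphere (0 : Cn n) 1 := by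
      refine ⟨hqb, ?_⟩
      rw [map_smul, mem_sphere_zero_iff_norm, norm_smul, ← hr, Complex.norm_real, norm_inv,
        Real.norm_of_nonneg hr0.le, inv_mul_cancel₀ hr0.ne']
    have hscale : ∀ k : HermitianMetric n X,
        (k.form q (((r⁻¹ : ℝ) : ℂ) • V) (((r⁻¹ : ℝ) : ℂ) • V)).re =
          r⁻¹ * (r⁻¹ * (k.form q V V).re) := fun k => by
      simp only [map_smul, LinearMap.smul_apply, LinearMap.map_smulₛₗ, Complex.conj_ofReal,
        smul_eq_mul, Complex.re_ofReal_mul]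
    have h1 := (le_abs_self _).trans (hM _ hmem)
    rw [Pi.div_apply, div_le_iff₀ (hpos _ hmem), chartForm_eq h he hq, chartForm_eq g he hq,
      hscale, hscale] at h1
    have hri : 0 < r⁻¹ := inv_pos.mpr hr0
    have h2 : r⁻¹ * (r⁻¹ * (h.form q V V).re) ≤ r⁻¹ * (r⁻¹ * (M * (g.form q V V).re)) := by
      linarith
    exact le_of_mul_le_mul_left (le_of_mul_le_mul_left h2 hri) hri

/-- Any two Hermitian metrics on a compact manifold are comparable. -/
lemma exists_le [CompactSpace X] (g h : HermitianMetric n X) :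
    ∃ M : ℝ, 0 < M ∧ ∀ p V, (h.form p V V).re ≤ M * (g.form p V V).re := by
  have hnonneg : ∀ p V, 0 ≤ (g.form p V V).re := fun p V => by
    rcases eq_or_ne V 0 with rfl | hV
    · simp
    · exact (g.pos p V hV).le
  have key : ∃ M : ℝ, 0 < M ∧ ∀ p ∈ (univ : Set X), ∀ V : TangentSpace 𝓘(ℂ, Cn n) p,
      (h.form p V V).re ≤ M * (g.form p V V).re := by
    refine isCompact_univ.induction_on (p := fun s => ∃ M : ℝ, 0 < M ∧ ∀ p ∈ s,
      ∀ V : TangentSpace 𝓘(ℂ, Cn n) p, (h.form p V V).re ≤ M * (g.form p V V).re)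
      ⟨1, one_pos, fun p hp => hp.elim⟩ ?_ ?_ ?_
    · rintro s t hst ⟨M, hM, h1⟩
      exact ⟨M, hM, fun p hp => h1 p (hst hp)⟩
    · rintro s t ⟨M, hM, h1⟩ ⟨M', hM', h2⟩
      refine ⟨M + M', add_pos hM hM', fun p hp V => ?_⟩
      rw [add_mul]
      rcases hp with hp | hp
      · have := mul_nonneg hM'.le (hnonneg p V)
        linarith [h1 p hp V]
      · have := mul_nonneg hM.le (hnonneg p V)
        linarith [h2 p hp V]
    · intro p _
      obtain ⟨s, hs, M, hM⟩ := exists_local_le g h p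
      refine ⟨s, mem_nhdsWithin_of_mem_nhds hs, |M| + 1, by positivity, fun q hq V => ?_⟩
      have h1 := mul_le_mul_of_nonneg_right (le_abs_self M) (hnonneg q V)
      have h2 := hnonneg q V
      linarith [hM q hq V]
  obtain ⟨M, hM, h1⟩ := key
  exact ⟨M, hM, fun p V => h1 p (mem_univ p) V⟩

end InitialComparison

/-! ### Arbitrary initial metrics and the final bound -/

lemma rescale_zero_form_re {n : ℕ} {X : Type*} [TopologicalSpace X] [ChartedSpace (Cn n) X]
    {l : ℝ} (hl : 0 < l) (g : ℝ → HermitianMetric n X) (p : X)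
    (V : TangentSpace 𝓘(ℂ, Cn n) p) :
    ((rescale l hl g 0).form p V V).re = l * ((g 0).form p V V).re := by
  rw [rescale_form_re l hl g le_rfl]
  simp [rescaleFactor, rescaleTime, hl.ne']

/-- Uniform bounds on the potential and on the volume ratio of two normalised Chern-Ricci flows,
one of which has bounded Ricci curvature. -/
lemma exists_potential_logRatio_bound {n : ℕ} {X : Type*} [TopologicalSpace X] [CompactSpace X]
    [ChartedSpace (Cn n) X] [IsManifold 𝓘(ℂ, Cn n) ω X] {g g' : ℝ → HermitianMetric n X}
    (hg : IsChernRicciFlow g) (hg' : IsChernRicciFlow g') {C : ℝ} (hC : 0 ≤ C)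
    (hRic : ∀ t, 0 ≤ t → ∀ p V,
      |(chernRicci (g' t) p V V).re| ≤ C * ((g' t).form p V V).re) :
    ∃ K L, ∀ p t, 0 ≤ t → |potential g g' p t| ≤ K ∧ |logRatio g g' p t| ≤ L := by
  -- These give M⁻¹ω̃₀ ≤ ω₀ ≤ Nω̃₀, so the rescaled flows start below and above ω₀.
  obtain ⟨M, hM, hM'⟩ := exists_le (g 0) (g' 0)
  obtain ⟨N, hN, hN'⟩ := exists_le (g' 0) (g 0)
  have hl : 0 < M⁻¹ := inv_pos.mpr hM
  have hgM := hg'.rescale hl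
  have hgN := hg'.rescale hN
  have h0M : ∀ p V, ((rescale M⁻¹ hl g' 0).form p V V).re ≤ ((g 0).form p V V).re := fun p V => by
    rw [rescale_zero_form_re, inv_mul_le_iff₀ hM]
    exact hM' p V
  have h0N : ∀ p V, ((g 0).form p V V).re ≤ ((rescale N hN g' 0).form p V V).re := fun p V => by
    rw [rescale_zero_form_re]
    exact hN' p V
  have hC' : 0 ≤ C * (min 1 M⁻¹)⁻¹ := mul_nonneg hC (inv_pos.mpr (lt_min one_pos hl)).le
  obtain ⟨K, hK⟩ := exists_abs_logRatio_le hg hgM h0M hC'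
    fun t ht p V => abs_chernRicci_rescale_le hRic hl ht p V
  set A := n * |Real.log M⁻¹| + (C + 1) * n * (2 * |Real.log M⁻¹|)
  set B := n * |Real.log N| + (C + 1) * n * (2 * |Real.log N|)
  have hA : 0 ≤ A := by positivity
  have hB : 0 ≤ B := by positivity
  refine ⟨A + B, (C * (min 1 M⁻¹)⁻¹ + 1) * (A + B) + K + A, fun p t ht => ?_⟩
  have hwM : ∀ s : ℝ, 0 ≤ s → _ := fun s hs =>
    abs_logRatio_sub_rescale_le g hg' hC hRic hl p hs
  have hwN : ∀ s : ℝ, 0 ≤ s → _ := fun s hs =>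
    abs_logRatio_sub_rescale_le g hg' hC hRic hN p hs
  have hvM := abs_le.mp (abs_potential_sub_le hg hg' hg hgM hwM ht)
  have hvN := abs_le.mp (abs_potential_sub_le hg hg' hg hgN hwN ht)
  -- The potential against the lower flow is nonnegative and against the upper one nonpositive,
  -- whence -A ≤ v ≤ B.
  have h1 := potential_nonneg hg hgM h0M p ht
  have h2 := potential_nonneg hgN hg h0N p ht
  rw [potential_swap] at h2
  have h3 : potential g (rescale M⁻¹ hl g') p t ≤ A + B := by linarith
  have h4 := mul_le_mul_of_nonneg_left h3 (add_nonneg hC' zero_le_one)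
  have h5 := abs_le.mp (hK p t ht)
  have h6 := abs_le.mp (hwM t ht)
  exact ⟨abs_le.mpr ⟨by linarith, by linarith⟩, abs_le.mpr ⟨by linarith, by linarith⟩⟩

end ChernRicci

end

theorem proposition2p2 {n : ℕ} {X : Type*} [TopologicalSpace X] [T2Space X] [CompactSpace X]
    [ChartedSpace (ChernRicci.Cn n) X] [IsManifold 𝓘(ℂ, ChernRicci.Cn n) ω X]
    (g g' : ℝ → ChernRicci.HermitianMetric n X)
    (hg : ChernRicci.IsChernRicciFlow g) (hg' : ChernRicci.IsChernRicciFlow g')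
    (C₀ : ℝ)
    (hRic : ∀ t : ℝ, 0 ≤ t →
      ChernRicci.Form11.LE (-((C₀ : ℂ) • (g' t).form)) (ChernRicci.chernRicci (g' t)) ∧
      ChernRicci.Form11.LE (ChernRicci.chernRicci (g' t)) ((C₀ : ℂ) • (g' t).form)) :
    (∀ (p : X) (t : ℝ), 0 ≤ t →
      DifferentiableWithinAt ℝ (ChernRicci.potential g g' p) (Set.Ici 0) t) ∧
    ∃ C : ℝ, 0 < C ∧ ∀ t : ℝ, 0 ≤ t → ∀ p q : X,
      |ChernRicci.potential g g' p t| +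
        |derivWithin (ChernRicci.potential g g' q) (Set.Ici 0) t| ≤ C := by
  -- `C₀` may be negative, so it is replaced by max(C₀, 0).
  have hbound : ∀ t, 0 ≤ t → ∀ (p : X) V, |(ChernRicci.chernRicci (g' t) p V V).re| ≤
      max C₀ 0 * ((g' t).form p V V).re := by
    intro t ht p V
    have h1 : -(C₀ * ((g' t).form p V V).re) ≤ (ChernRicci.chernRicci (g' t) p V V).re := by
      have := (hRic t ht).1 p V
      rwa [show (-((C₀ : ℂ) • (g' t).form)) p V V = -((C₀ : ℂ) * (g' t).form p V V) from rfl,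
        Complex.neg_re, Complex.re_ofReal_mul] at this
    have h2 : (ChernRicci.chernRicci (g' t) p V V).re ≤ C₀ * ((g' t).form p V V).re := by
      have := (hRic t ht).2 p V
      rwa [show ((C₀ : ℂ) • (g' t).form) p V V = (C₀ : ℂ) * (g' t).form p V V from rfl,
        Complex.re_ofReal_mul] at this
    have h3 : 0 ≤ ((g' t).form p V V).re := by
      rcases eq_or_ne V 0 with rfl | hV
      · simp
      · exact ((g' t).pos p V hV).le
    exact (abs_le.mpr ⟨h1, h2⟩).trans (mul_le_mul_of_nonneg_right (le_max_left _ _) h3)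
  obtain ⟨K, L, h⟩ := ChernRicci.exists_potential_logRatio_bound hg hg' (le_max_right C₀ 0) hbound
  -- One |K| bounds v at `p`, |L| + |K| bounds ∂v/∂t = w - v at `q`, and 1 makes the constant
  -- positive.
  refine ⟨fun p t ht => (ChernRicci.hasDerivWithinAt_potential hg hg' p ht).differentiableWithinAt,
    |K| + |L| + |K| + 1, by positivity, fun t ht p q => ?_⟩
  rw [(ChernRicci.hasDerivWithinAt_potential hg hg' q ht).derivWithin
    (uniqueDiffOn_Ici (0 : ℝ) t ht)]
  have h1 := (h p t ht).1.trans (le_abs_self K)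
  have h2 := (h q t ht).1.trans (le_abs_self K)
  have h3 := (h q t ht).2.trans (le_abs_self L)
  have h4 := abs_sub (ChernRicci.logRatio g g' q t) (ChernRicci.potential g g' q t)
  linarith
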